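/- Let $\mathbf C^2_1$ be $\mathbb C^2$ with complex structure $J$ (multiplication by $\mathrm i$) and the metric $\langle z,w\rangle=\operatorname{Re}(-\bar z_1w_1+\bar z_2w_2)$. Let $L:M\to\mathbf C^2_1$ be a smooth immersion of a connected smooth surface whose induced metric is Lorentzian, and let $\theta\in\mathbb R$. Assume that $L$ is minimal (its mean curvature vector vanishes), flat (the curvature tensor of the induced metric vanishes) and $\theta$-slant: every tangent plane has a basis $e_1,e_2$ with $\langle e_1,e_1\rangle=\langle e_2,e_2\rangle=0$, $\langle e_1,e_2\rangle=-1$, $Pe_1=(\sinh\theta)\,e_1$, $Pe_2=-(\sinh\theta)\,e_2$, where $PX$ is the tangential component of $JX$. (The order of $e_1,e_2$ is not prescribed; exchanging them changes the sign of $\theta$.) A rigid motion is an affine bijection of $\mathbf C^2_1$ that preserves the metric and is holomorphic or anti-holomorphic. For open intervals $I,K\subset\mathbb R$, a null rectangle is a smooth map $\varphi:I\times K\to M$ that pulls the induced metric back to $-dx\otimes dy-dy\otimes dx$. Then one of the following holds. (a) $L(M)$ is an open piece of a (totally geodesic) real affine plane of $\mathbf C^2_1$ which is $\theta$-slant. (b)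 $L$ is not totally geodesic and is, on null rectangles, congruent to $$\psi(x,y)=\Big(x+\tfrac y2\cosh^2\theta+(\mathrm i-\sinh\theta)f(y),\; x-y+\tfrac y2\cosh^2\theta+(\mathrm i-\sinh\theta)f(y)-\mathrm i\,y\sinh\theta\Big)$$ in the following sense. Every point of $M$ lies in the image of an injective null rectangle $\varphi:I\times K\to M$ for which there are a smooth function $f:K\to\mathbb R$ and a rigid motion $\Phi$ with $L(\varphi(x,y))=\Phi(\psi(x,y))$ on $I\times K$. Moreover, for every null rectangle $\varphi:I\times K\to M$ there are a rigid motion $\Phi$ and either a smooth $f:K\to\mathbb R$ with $L(\varphi(x,y))=\Phi(\psi(x,y))$ on all of $I\times K$, or a smooth $f:I\to\mathbb R$ with $L(\varphi(x,y))=\Phi(\psi(y,x))$ on all of $I\times K$. -/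

import Mathlib

open scoped Manifold ContDiff

noncomputable section

namespace LorentzianC2

/-- The coordinate plane `ℝ²` in which the charts of a surface take their values. -/
abbrev E2 : Type := EuclideanSpace ℝ (Fin 2)

/-! ### The Lorentzian complex plane `ℂ²₁` -/

/-- The Hermitian form `b(z, w) = - z̄₁ w₁ + z̄₂ w₂` on `ℂ²`. -/
def herm (z w : ℂ × ℂ) : ℂ :=
  -(starRingEnd ℂ z.1 * w.1) + starRingEnd ℂ z.2 * w.2

/-- The metric `⟨z, w⟩ = Re b(z, w)` of `ℂ²₁`. -/
def metric (z w : ℂ × ℂ) : ℝ := (herm z w).re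

/-- The complex structure `J` of `ℂ²₁`, i.e. multiplication by the imaginary unit. -/
def cplxJ (z : ℂ × ℂ) : ℂ × ℂ := Complex.I • z

/-- A rigid motion of `ℂ²₁`: an affine bijection that preserves the metric and preserves
the complex structure up to sign (a holomorphic or anti-holomorphic isometry). -/
def IsMotion (Φ : (ℂ × ℂ) ≃ᵃ[ℝ] (ℂ × ℂ)) : Prop :=
  (∀ z w, metric (Φ.linear z) (Φ.linear w) = metric z w) ∧
    ((∀ z, Φ.linear (cplxJ z) = cplxJ (Φ.linear z)) ∨
      (∀ z, Φ.linear (cplxJ z) = -cplxJ (Φ.linear z)))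

/-! ### Lorentzian planes and their Wirtinger angle -/

/-- A real two-dimensional subspace on which the metric has signature `(1, 1)`. -/
def IsLorentzianPlane (W : Submodule ℝ (ℂ × ℂ)) : Prop :=
  Module.finrank ℝ W = 2 ∧ (∃ v ∈ W, metric v v < 0) ∧ ∃ v ∈ W, 0 < metric v v

/-- `v` is the component of `z` tangential to `W`: `v ∈ W` and `z - v ⊥ W`. -/
def IsTangentialPart (W : Submodule ℝ (ℂ × ℂ)) (z v : ℂ × ℂ) : Prop :=
  v ∈ W ∧ ∀ w ∈ W, metric (z - v) w = 0

/-- `W` is a Lorentzian plane with Wirtinger angle `θ`: it has a pseudo-orthonormal basis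
`e₁, e₂` such that `P e₁ = sinh θ e₁` and `P e₂ = - sinh θ e₂`, where `P v` is the tangential
part of `J v`. (Exchanging `e₁` and `e₂` changes the sign of `θ`.) -/
def IsSlantPlane (θ : ℝ) (W : Submodule ℝ (ℂ × ℂ)) : Prop :=
  IsLorentzianPlane W ∧ ∃ e₁ ∈ W, ∃ e₂ ∈ W,
    metric e₁ e₁ = 0 ∧ metric e₂ e₂ = 0 ∧ metric e₁ e₂ = -1 ∧
    IsTangentialPart W (cplxJ e₁) (Real.sinh θ • e₁) ∧
    IsTangentialPart W (cplxJ e₂) (-Real.sinh θ • e₂)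

/-! ### Local geometry of a parametrized surface `F : ℝ² → ℂ²₁` -/

/-- The partial derivative `∂ᵢ f`. -/
def pd {V : Type*} [NormedAddCommGroup V] [NormedSpace ℝ V]
    (i : Fin 2) (f : E2 → V) (u : E2) : V :=
  fderiv ℝ f u (EuclideanSpace.single i 1)

/-- The tangent plane at the parameter `u`. -/
def tangentPlane (F : E2 → ℂ × ℂ) (u : E2) : Submodule ℝ (ℂ × ℂ) :=
  LinearMap.range (fderiv ℝ F u : E2 →ₗ[ℝ] ℂ × ℂ)

/-- The matrix `g_ij = ⟨∂ᵢ F, ∂ⱼ F⟩` of the induced metric. -/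
def gram (F : E2 → ℂ × ℂ) (u : E2) : Matrix (Fin 2) (Fin 2) ℝ :=
  Matrix.of fun i j => metric (pd i F u) (pd j F u)

/-- The Christoffel symbols `Γᵏᵢⱼ` of the Levi-Civita connection of the induced metric. -/
def christoffel (F : E2 → ℂ × ℂ) (k i j : Fin 2) (u : E2) : ℝ :=
  1 / 2 * ∑ l, (gram F u)⁻¹ k l *
    (pd i (fun v => gram F v j l) u + pd j (fun v => gram F v i l) u
      - pd l (fun v => gram F v i j) u)

/-- The components `Rˡ_{kij}` of the curvature tensor of the induced metric:
`R(∂ᵢ, ∂ⱼ) ∂ₖ = ∑ₗ Rˡ_{kij} ∂ₗ`. -/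
def curvature (F : E2 → ℂ × ℂ) (l k i j : Fin 2) (u : E2) : ℝ :=
  pd i (christoffel F l j k) u - pd j (christoffel F l i k) u
    + ∑ m, (christoffel F l i m u * christoffel F m j k u
      - christoffel F l j m u * christoffel F m i k u)

/-- The second fundamental form `h(∂ᵢ, ∂ⱼ) = ∂ᵢ∂ⱼ F - ∑ₖ Γᵏᵢⱼ ∂ₖ F` (formula of Gauss). -/
def secondForm (F : E2 → ℂ × ℂ) (i j : Fin 2) (u : E2) : ℂ × ℂ :=
  pd i (pd j F) u - ∑ k, christoffel F k i j u • pd k F u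

/-- The mean curvature vector `H = ½ trace h`. -/
def meanCurvature (F : E2 → ℂ × ℂ) (u : E2) : ℂ × ℂ :=
  (1 / 2 : ℝ) • ∑ i, ∑ j, (gram F u)⁻¹ i j • secondForm F i j u

/-! ### Surfaces in `ℂ²₁`

`M` is a smooth surface and `L : M → ℂ²₁`. Geometric quantities are computed in the charts `e` of
the atlas, that is for the parametrized surfaces `L ∘ e⁻¹`. -/

section Surfaces

variable {M : Type*} [TopologicalSpace M] [ChartedSpace E2 M]

/-- A property of parametrized surfaces at a parameter point holds everywhere on the surface `L`,
in all charts of the atlas. -/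
def InCharts (L : M → ℂ × ℂ) (Q : (E2 → ℂ × ℂ) → E2 → Prop) : Prop :=
  ∀ e ∈ atlas E2 M, ∀ u ∈ e.target, Q (L ∘ e.symm) u

/-- `L` is a smooth immersion whose induced metric is Lorentzian. -/
structure IsLorentzianSurface (L : M → ℂ × ℂ) : Prop where
  smooth : ContMDiff (𝓡 2) 𝓘(ℝ, ℂ × ℂ) ∞ L
  lorentzian : InCharts L fun F u => IsLorentzianPlane (tangentPlane F u)

/-- The mean curvature vector vanishes identically. -/
def IsMinimal (L : M → ℂ × ℂ) : Prop :=
  InCharts L fun F u => meanCurvature F u = 0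

/-- The curvature tensor of the induced metric vanishes identically. -/
def IsFlat (L : M → ℂ × ℂ) : Prop :=
  InCharts L fun F u => ∀ l k i j, curvature F l k i j u = 0

/-- The Wirtinger angle is the constant `θ`. -/
def IsSlant (θ : ℝ) (L : M → ℂ × ℂ) : Prop :=
  InCharts L fun F u => IsSlantPlane θ (tangentPlane F u)

/-- The second fundamental form vanishes identically. -/
def IsTotallyGeodesic (L : M → ℂ × ℂ) : Prop :=
  InCharts L fun F u => ∀ i j, secondForm F i j u = 0

/-- The image of `L` is an open piece of an affine real plane of `ℂ²₁` (a totally geodesic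
surface) whose Wirtinger angle is `θ`. -/
def IsOpenPieceOfSlantPlane (θ : ℝ) (L : M → ℂ × ℂ) : Prop :=
  ∃ A : AffineSubspace ℝ (ℂ × ℂ), IsSlantPlane θ A.direction ∧
    ∃ O : Set (ℂ × ℂ), IsOpen O ∧ Set.range L = (A : Set (ℂ × ℂ)) ∩ O

/-- `φ` is a local isometry into `M` (with the metric induced by `L`) from the rectangle `I × K`
of the Lorentzian plane with metric `- dx ⊗ dy - dy ⊗ dx`, for open intervals `I` and `K`. -/
structure IsNullRectangle (L : M → ℂ × ℂ) (I K : Set ℝ) (φ : ℝ × ℝ → M) : Prop where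
  open_left : IsOpen I
  interval_left : I.OrdConnected
  open_right : IsOpen K
  interval_right : K.OrdConnected
  smooth : ContMDiffOn 𝓘(ℝ, ℝ × ℝ) (𝓡 2) ∞ φ (I ×ˢ K)
  isometric : ∀ q ∈ I ×ˢ K, ∀ v w : ℝ × ℝ,
    metric (fderiv ℝ (L ∘ φ) q v) (fderiv ℝ (L ∘ φ) q w) = -(v.1 * w.2) - v.2 * w.1

end Surfaces

/-! ### The explicit surfaces -/

/-- The surface `ψ(x, y)` with angle `θ` and function `f(y)`. -/
def model (θ : ℝ) (f : ℝ → ℝ) (q : ℝ × ℝ) : ℂ × ℂ :=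
  let x := q.1
  let y := q.2
  ((x : ℂ) + y / 2 * (Real.cosh θ : ℂ) ^ 2 + (Complex.I - (Real.sinh θ : ℂ)) * (f y : ℂ),
    (x : ℂ) - y + y / 2 * (Real.cosh θ : ℂ) ^ 2 + (Complex.I - (Real.sinh θ : ℂ)) * (f y : ℂ)
      - Complex.I * y * (Real.sinh θ : ℂ))

/-- On `I × K` the parametrized surface `F` agrees, up to a rigid motion of `ℂ²₁`, with the explicit
surface for `θ` and some smooth function `f` on `K`. -/
def CongruentToModel (θ : ℝ) (F : ℝ × ℝ → ℂ × ℂ) (I K : Set ℝ) : Prop :=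
  ∃ f : ℝ → ℝ, ContDiffOn ℝ ∞ f K ∧
    ∃ Φ : (ℂ × ℂ) ≃ᵃ[ℝ] (ℂ × ℂ), IsMotion Φ ∧
      ∀ q ∈ I ×ˢ K, F q = Φ (model θ f q)

end LorentzianC2

end

noncomputable section

namespace LorentzianC2

/-! ### The metric as a bilinear form -/

/-! A flat Lorentzian surface has local coordinates in which the metric is `-dx ⊗ dy - dy ⊗ dx`.
Rescaling a null frame makes it parallel, because flatness and the Gauss equation close its
connection form. The 1-forms dual to the parallel frame are then closed, and their primitives are
`x` and `y` (`exists_null_coordinates`). Inverting these coordinates gives the null rectangles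
(`exists_isNullRectangle`).

On a null rectangle the second derivatives of `L` are normal, and the mean curvature vector is
`-L_xy`. Minimality therefore says `L_xy = 0`: `X = L_x` depends only on `x`, and `Y = L_y` only on
`y`. The slant condition fixes the Hermitian product `b(X, Y) = -1 ± i sinh θ`, with one sign on the
whole rectangle. As the variables separate, `b(X(x), Y(y'))` is the same nonzero constant for all
`x` and `y'`. If `X` takes two different values, this forces `Y` to be constant (`eq_of_herm_eq`);
so `X` or `Y` is constant.

Suppose `X` is constant. A complex linear isometry carries it to `(1, 1)`, preceded by a conjugation
if the sign is wrong. Null vectors with a given product with `(1, 1)` form a real affine line of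
direction `(i - sinh θ)(1, 1)` (`exists_real_of_null`); integrating `Y` along `y` gives the model,
with `f` a primitive of the line parameter. If `Y` is constant, the coordinates are exchanged.

If `L` is totally geodesic it is affine on null rectangles. The local planes agree on overlaps, so
connectedness yields a single plane. -/

theorem metric_eq_re_im (z w : ℂ × ℂ) :
    metric z w = -(z.1.re * w.1.re + z.1.im * w.1.im) + (z.2.re * w.2.re + z.2.im * w.2.im) := by
  simp [metric, herm]

theorem metric_comm (z w : ℂ × ℂ) : metric z w = metric w z := by
  simp only [metric_eq_re_im]; ring

theorem metric_add_left (z z' w : ℂ × ℂ) : metric (z + z') w = metric z w + metric z' w := by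
  simp only [metric_eq_re_im, Prod.fst_add, Prod.snd_add, Complex.add_re, Complex.add_im]; ring

theorem metric_smul_left (c : ℝ) (z w : ℂ × ℂ) : metric (c • z) w = c * metric z w := by
  simp only [metric_eq_re_im, Prod.smul_fst, Prod.smul_snd, Complex.smul_re, Complex.smul_im,
    smul_eq_mul]
  ring

theorem metric_add_right (z w w' : ℂ × ℂ) : metric z (w + w') = metric z w + metric z w' := by
  rw [metric_comm, metric_add_left, metric_comm w, metric_comm w']

theorem metric_smul_right (c : ℝ) (z w : ℂ × ℂ) : metric z (c • w) = c * metric z w := by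
  rw [metric_comm, metric_smul_left, metric_comm w]

/-- The metric of `ℂ²₁` as a bilinear form. -/
def metricForm : (ℂ × ℂ) →ₗ[ℝ] (ℂ × ℂ) →ₗ[ℝ] ℝ :=
  LinearMap.mk₂ ℝ metric metric_add_left metric_smul_left metric_add_right metric_smul_right

theorem metricForm_apply (z w : ℂ × ℂ) : metricForm z w = metric z w := rfl

theorem metric_sub_left (z z' w : ℂ × ℂ) : metric (z - z') w = metric z w - metric z' w := by
  simp only [← metricForm_apply, map_sub, LinearMap.sub_apply]

theorem metric_sub_right (z w w' : ℂ × ℂ) : metric z (w - w') = metric z w - metric z w' := by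
  simp only [← metricForm_apply, map_sub]

theorem metric_zero_left (w : ℂ × ℂ) : metric 0 w = 0 := by
  simp only [← metricForm_apply, map_zero, LinearMap.zero_apply]

theorem metric_sum_left {ι : Type*} (s : Finset ι) (f : ι → ℂ × ℂ) (w : ℂ × ℂ) :
    metric (∑ i ∈ s, f i) w = ∑ i ∈ s, metric (f i) w := by
  simp only [← metricForm_apply, map_sum, LinearMap.sum_apply]

theorem isBoundedBilinearMap_metric :
    IsBoundedBilinearMap ℝ fun p : (ℂ × ℂ) × (ℂ × ℂ) => metric p.1 p.2 :=
  ((LinearMap.toContinuousLinearMap : ((ℂ × ℂ) →ₗ[ℝ] ℝ) ≃ₗ[ℝ] _).toLinearMap ∘ₗ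
    metricForm).toContinuousLinearMap.isBoundedBilinearMap

/-! ### Derivatives -/

section Calculus

variable {E V : Type*} [NormedAddCommGroup E] [NormedSpace ℝ E]
  [NormedAddCommGroup V] [NormedSpace ℝ V] {U : Set E} {u : E}

theorem _root_.ContDiffOn.metric {f g : E → ℂ × ℂ} (hf : ContDiffOn ℝ ∞ f U)
    (hg : ContDiffOn ℝ ∞ g U) : ContDiffOn ℝ ∞ (fun u => metric (f u) (g u)) U :=
  isBoundedBilinearMap_metric.contDiff.comp_contDiffOn (hf.prodMk hg)

theorem fderiv_metric {f g : E → ℂ × ℂ} (hf : DifferentiableAt ℝ f u)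
    (hg : DifferentiableAt ℝ g u) (v : E) :
    fderiv ℝ (fun u => metric (f u) (g u)) u v =
      metric (fderiv ℝ f u v) (g u) + metric (f u) (fderiv ℝ g u v) := by
  have := (isBoundedBilinearMap_metric.hasFDerivAt (f u, g u)).comp u
    (hf.hasFDerivAt.prodMk hg.hasFDerivAt)
  rw [show (fun u => metric (f u) (g u)) =
    (fun p : (ℂ × ℂ) × (ℂ × ℂ) => metric p.1 p.2) ∘ fun u => (f u, g u) from rfl, this.fderiv]
  simp [IsBoundedBilinearMap.deriv, add_comm]

theorem fderiv_smul_apply {c : E → ℝ} {f : E → V} (hc : DifferentiableAt ℝ c u)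
    (hf : DifferentiableAt ℝ f u) (v : E) :
    fderiv ℝ (fun u => c u • f u) u v = fderiv ℝ c u v • f u + c u • fderiv ℝ f u v := by
  rw [fderiv_fun_smul hc hf]
  simp [add_comm]

theorem _root_.ContDiffOn.differentiableAt_of_isOpen {f : E → V}
    (hf : ContDiffOn ℝ ∞ f U) (hU : IsOpen U) (hu : u ∈ U) : DifferentiableAt ℝ f u :=
  (hf.contDiffAt (hU.mem_nhds hu)).differentiableAt (by simp)

theorem _root_.ContDiffOn.fderiv_apply_const {f : E → V} (hf : ContDiffOn ℝ ∞ f U)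
    (hU : IsOpen U) (v : E) :
    ContDiffOn ℝ ∞ (fun u => fderiv ℝ f u v) U :=
  (hf.fderiv_of_isOpen hU (m := ∞) (by simp)).clm_apply contDiffOn_const

theorem fderiv_fderiv_comm {f : E → V} (hf : ContDiffOn ℝ ∞ f U) (hU : IsOpen U) (hu : u ∈ U)
    (v w : E) :
    fderiv ℝ (fun u => fderiv ℝ f u w) u v = fderiv ℝ (fun u => fderiv ℝ f u v) u w := by
  have hd : DifferentiableAt ℝ (fderiv ℝ f) u :=
    ((hf.fderiv_of_isOpen hU (m := ∞) (by simp))).differentiableAt_of_isOpen hU hu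
  have h := (hf.contDiffAt (hU.mem_nhds hu)).isSymmSndFDerivAt (n := ∞) (by simpa using WithTop.coe_le_coe.2 (le_top (a := (2 : ℕ∞))))
  have key : ∀ v w : E, fderiv ℝ (fun u => fderiv ℝ f u w) u v = fderiv ℝ (fderiv ℝ f) u v w := by
    intro v w
    rw [fderiv_clm_apply hd (differentiableAt_const w)]
    simp
  rw [key, key]
  exact h v w

/-- If the metric induced by `G` is constant, then second derivatives of `G` are normal. -/
theorem metric_fderiv_fderiv_eq_zero {G : E → ℂ × ℂ} (hG : ContDiffOn ℝ ∞ G U) (hU : IsOpen U)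
    (c : E → E → ℝ)
    (hc : ∀ u ∈ U, ∀ v w, metric (fderiv ℝ G u v) (fderiv ℝ G u w) = c v w) (hu : u ∈ U)
    (v w z : E) : metric (fderiv ℝ (fun u => fderiv ℝ G u w) u v) (fderiv ℝ G u z) = 0 := by
  have key : ∀ v w z : E, metric (fderiv ℝ (fun u => fderiv ℝ G u w) u v) (fderiv ℝ G u z) +
      metric (fderiv ℝ (fun u => fderiv ℝ G u z) u v) (fderiv ℝ G u w) = 0 := by
    intro v w z
    have h0 : fderiv ℝ (fun u => metric (fderiv ℝ G u w) (fderiv ℝ G u z)) u v = 0 := by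
      have : (fun u => metric (fderiv ℝ G u w) (fderiv ℝ G u z)) =ᶠ[nhds u] fun _ => c w z := by
        filter_upwards [hU.mem_nhds hu] with x hx using hc x hx w z
      rw [this.fderiv_eq]; simp
    rw [fderiv_metric ((hG.fderiv_apply_const hU w).differentiableAt_of_isOpen hU hu)
      ((hG.fderiv_apply_const hU z).differentiableAt_of_isOpen hU hu)] at h0
    rw [metric_comm _ (fderiv ℝ G u w)]
    exact h0
  -- The trilinear form `⟨∂ᵥ∂_w G, ∂_z G⟩` is symmetric in `v, w` and, by `key`, antisymmetric in
  -- `w, z`; such a form is zero.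
  have h1 := key v w z
  have h2 := key w z v
  have h3 := key z v w
  rw [fderiv_fderiv_comm hG hU hu v z] at h1
  rw [fderiv_fderiv_comm hG hU hu w v] at h2
  rw [fderiv_fderiv_comm hG hU hu z w] at h3
  linarith

end Calculus

/-! ### The equation of Gauss -/

section Gauss

variable {F : E2 → ℂ × ℂ} {U : Set E2} {u : E2}

theorem _root_.ContDiffOn.pd {V : Type*} [NormedAddCommGroup V] [NormedSpace ℝ V] {f : E2 → V}
    (hf : ContDiffOn ℝ ∞ f U) (hU : IsOpen U) (i : Fin 2) : ContDiffOn ℝ ∞ (pd i f) U :=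
  hf.fderiv_apply_const hU _

theorem pd_comm {V : Type*} [NormedAddCommGroup V] [NormedSpace ℝ V] {f : E2 → V}
    (hf : ContDiffOn ℝ ∞ f U) (hU : IsOpen U) (hu : u ∈ U) (i j : Fin 2) :
    pd i (pd j f) u = pd j (pd i f) u :=
  fderiv_fderiv_comm hf hU hu _ _

theorem pd_metric {f g : E2 → ℂ × ℂ} (hf : ContDiffOn ℝ ∞ f U) (hg : ContDiffOn ℝ ∞ g U)
    (hU : IsOpen U) (hu : u ∈ U) (i : Fin 2) :
    pd i (fun u => metric (f u) (g u)) u =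
      metric (pd i f u) (g u) + metric (f u) (pd i g u) :=
  fderiv_metric (hf.differentiableAt_of_isOpen hU hu) (hg.differentiableAt_of_isOpen hU hu) _

theorem pd_smul {V : Type*} [NormedAddCommGroup V] [NormedSpace ℝ V] {c : E2 → ℝ} {f : E2 → V}
    (hc : ContDiffOn ℝ ∞ c U) (hf : ContDiffOn ℝ ∞ f U) (hU : IsOpen U) (hu : u ∈ U) (i : Fin 2) :
    pd i (fun u => c u • f u) u = pd i c u • f u + c u • pd i f u :=
  fderiv_smul_apply (hc.differentiableAt_of_isOpen hU hu) (hf.differentiableAt_of_isOpen hU hu) _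

theorem pd_congr {V : Type*} [NormedAddCommGroup V] [NormedSpace ℝ V] {f g : E2 → V}
    (h : Set.EqOn f g U) (hU : IsOpen U) (hu : u ∈ U) (i : Fin 2) : pd i f u = pd i g u := by
  have : f =ᶠ[nhds u] g := by filter_upwards [hU.mem_nhds hu] with x hx using h hx
  simp only [pd, this.fderiv_eq]

theorem pd_add {V : Type*} [NormedAddCommGroup V] [NormedSpace ℝ V] {f g : E2 → V}
    (hf : ContDiffOn ℝ ∞ f U) (hg : ContDiffOn ℝ ∞ g U) (hU : IsOpen U) (hu : u ∈ U) (i : Fin 2) :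
    pd i (fun u => f u + g u) u = pd i f u + pd i g u := by
  simp only [pd]
  rw [fderiv_fun_add (hf.differentiableAt_of_isOpen hU hu) (hg.differentiableAt_of_isOpen hU hu)]
  simp

theorem pd_sub {V : Type*} [NormedAddCommGroup V] [NormedSpace ℝ V] {f g : E2 → V}
    (hf : ContDiffOn ℝ ∞ f U) (hg : ContDiffOn ℝ ∞ g U) (hU : IsOpen U) (hu : u ∈ U) (i : Fin 2) :
    pd i (fun u => f u - g u) u = pd i f u - pd i g u := by
  simp only [pd]
  rw [fderiv_fun_sub (hf.differentiableAt_of_isOpen hU hu) (hg.differentiableAt_of_isOpen hU hu)]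
  simp

theorem fderiv_apply_eq_pd {V : Type*} [NormedAddCommGroup V] [NormedSpace ℝ V] (f : E2 → V)
    (u v : E2) : fderiv ℝ f u v = v 0 • pd 0 f u + v 1 • pd 1 f u := by
  have : v = v 0 • EuclideanSpace.single 0 (1 : ℝ) + v 1 • EuclideanSpace.single 1 (1 : ℝ) := by
    ext i; fin_cases i <;> simp
  conv_lhs => rw [this]
  simp [pd]

theorem gram_apply (F : E2 → ℂ × ℂ) (u : E2) (i j : Fin 2) :
    gram F u i j = metric (pd i F u) (pd j F u) := rfl

theorem gram_comm (F : E2 → ℂ × ℂ) (u : E2) (i j : Fin 2) : gram F u i j = gram F u j i :=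
  metric_comm _ _

theorem contDiffOn_gram (hF : ContDiffOn ℝ ∞ F U) (hU : IsOpen U) (i j : Fin 2) :
    ContDiffOn ℝ ∞ (fun u => gram F u i j) U :=
  (hF.pd hU i).metric (hF.pd hU j)

theorem contDiffOn_gram_inv (hF : ContDiffOn ℝ ∞ F U) (hU : IsOpen U)
    (hdet : ∀ u ∈ U, (gram F u).det ≠ 0) (i j : Fin 2) :
    ContDiffOn ℝ ∞ (fun u => (gram F u)⁻¹ i j) U := by
  have h := contDiffOn_gram hF hU
  have hd : ContDiffOn ℝ ∞ (fun u => (gram F u).det) U := by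
    simp only [Matrix.det_fin_two]
    exact ((h 0 0).mul (h 1 1)).sub ((h 0 1).mul (h 1 0))
  have hi := hd.inv hdet
  simp only [Matrix.inv_def, Ring.inverse_eq_inv', Matrix.smul_apply, smul_eq_mul,
    Matrix.adjugate_fin_two]
  fin_cases i <;> fin_cases j
  · exact hi.mul (h 1 1)
  · exact hi.mul (h 0 1).neg
  · exact hi.mul (h 1 0).neg
  · exact hi.mul (h 0 0)

theorem contDiffOn_christoffel (hF : ContDiffOn ℝ ∞ F U) (hU : IsOpen U)
    (hdet : ∀ u ∈ U, (gram F u).det ≠ 0) (k i j : Fin 2) :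
    ContDiffOn ℝ ∞ (christoffel F k i j) U := by
  unfold christoffel
  refine contDiffOn_const.mul (ContDiffOn.sum fun l _ => ?_)
  exact (contDiffOn_gram_inv hF hU hdet k l).mul
    ((((contDiffOn_gram hF hU j l).pd hU i).add ((contDiffOn_gram hF hU i l).pd hU j)).sub
      ((contDiffOn_gram hF hU i j).pd hU l))

theorem contDiffOn_secondForm (hF : ContDiffOn ℝ ∞ F U) (hU : IsOpen U)
    (hdet : ∀ u ∈ U, (gram F u).det ≠ 0) (i j : Fin 2) :
    ContDiffOn ℝ ∞ (secondForm F i j) U :=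
  ((hF.pd hU j).pd hU i).sub (ContDiffOn.sum fun k _ =>
    (contDiffOn_christoffel hF hU hdet k i j).smul (hF.pd hU k))

/-- Koszul's formula with the index lowered: `∑ₖ Γᵏᵢⱼ ∂ₖF` is the tangential part of `∂ᵢ∂ⱼF`, which
makes the second fundamental form normal. -/
theorem sum_christoffel_gram (hF : ContDiffOn ℝ ∞ F U) (hU : IsOpen U) (hu : u ∈ U)
    (hdet : (gram F u).det ≠ 0) (i j l : Fin 2) :
    ∑ k, christoffel F k i j u * gram F u k l = metric (pd i (pd j F) u) (pd l F u) := by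
  have h1 : ∀ i j l : Fin 2, pd i (fun v => gram F v j l) u =
      metric (pd i (pd j F) u) (pd l F u) + metric (pd j F u) (pd i (pd l F) u) :=
    fun i j l => pd_metric (hF.pd hU j) (hF.pd hU l) hU hu i
  let T : Fin 2 → ℝ := fun l => pd i (fun v => gram F v j l) u + pd j (fun v => gram F v i l) u
      - pd l (fun v => gram F v i j) u
  have hT : T l = 2 * metric (pd i (pd j F) u) (pd l F u) := by
    simp only [T, h1]
    rw [pd_comm hF hU hu j i, pd_comm hF hU hu l i, pd_comm hF hU hu l j,
      metric_comm (pd i F u), metric_comm (pd j F u)]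
    ring
  have h2 : ∀ k, christoffel F k i j u = 1 / 2 * ((gram F u)⁻¹.mulVec T) k := fun k => rfl
  have h3 : (gram F u).mulVec ((gram F u)⁻¹.mulVec T) = T := by
    rw [Matrix.mulVec_mulVec, Matrix.mul_nonsing_inv _ (isUnit_iff_ne_zero.2 hdet),
      Matrix.one_mulVec]
  have h4 := congrFun h3 l
  rw [hT] at h4
  simp only [h2, Fin.sum_univ_two]
  simp only [Matrix.mulVec, dotProduct, Fin.sum_univ_two] at h4 ⊢
  rw [gram_comm F u 0 l, gram_comm F u 1 l]
  linarith

theorem metric_secondForm_pd (hF : ContDiffOn ℝ ∞ F U) (hU : IsOpen U) (hu : u ∈ U)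
    (hdet : (gram F u).det ≠ 0) (i j l : Fin 2) :
    metric (secondForm F i j u) (pd l F u) = 0 := by
  have := sum_christoffel_gram hF hU hu hdet i j l
  simp only [secondForm, metric_sub_left, metric_sum_left, metric_smul_left]
  simp only [gram_apply] at this
  rw [this, sub_self]

theorem pd_pd_eq (F : E2 → ℂ × ℂ) (i j : Fin 2) (u : E2) :
    pd i (pd j F) u = christoffel F 0 i j u • pd 0 F u + christoffel F 1 i j u • pd 1 F u
      + secondForm F i j u := by
  simp [secondForm, Fin.sum_univ_two]

/-- Differentiating `⟨h_jk, ∂ₗF⟩ = 0` gives `⟨∂ᵢh_jk, ∂ₗF⟩ = -⟨h_jk, h_il⟩`. Antisymmetrizing in `i,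
j` removes the third derivatives of `F` and leaves the lowered curvature, here zero. -/
theorem gauss_equation (hF : ContDiffOn ℝ ∞ F U) (hU : IsOpen U)
    (hdet : ∀ u ∈ U, (gram F u).det ≠ 0) (hu : u ∈ U)
    (hflat : ∀ l k i j, curvature F l k i j u = 0) (i j k l : Fin 2) :
    metric (secondForm F j k u) (secondForm F i l u) =
      metric (secondForm F i k u) (secondForm F j l u) := by
  have hC := contDiffOn_christoffel hF hU hdet
  have hn : ∀ i j k l, metric (pd i (secondForm F j k) u) (pd l F u) =
      -metric (secondForm F j k u) (secondForm F i l u) := by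
    intro i j k l
    have h0 : pd i (fun u => metric (secondForm F j k u) (pd l F u)) u = 0 := by
      rw [pd_congr (g := fun _ => 0)
        (fun x hx => metric_secondForm_pd hF hU hx (hdet x hx) j k l) hU hu i]
      simp [pd]
    rw [pd_metric (contDiffOn_secondForm hF hU hdet j k) (hF.pd hU l) hU hu, pd_pd_eq,
      metric_add_right, metric_add_right, metric_smul_right, metric_smul_right,
      metric_secondForm_pd hF hU hu (hdet u hu), metric_secondForm_pd hF hU hu (hdet u hu)] at h0
    linarith
  have hd : ∀ i j k, pd i (secondForm F j k) u = pd i (pd j (pd k F)) u -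
      ((pd i (christoffel F 0 j k) u • pd 0 F u + christoffel F 0 j k u • pd i (pd 0 F) u) +
       (pd i (christoffel F 1 j k) u • pd 1 F u + christoffel F 1 j k u • pd i (pd 1 F) u)) := by
    intro i j k
    have : secondForm F j k = fun u => pd j (pd k F) u -
        (christoffel F 0 j k u • pd 0 F u + christoffel F 1 j k u • pd 1 F u) := by
      funext v; simp [secondForm, Fin.sum_univ_two]
    have s : ∀ m, ContDiffOn ℝ ∞ (fun u => christoffel F m j k u • pd m F u) U :=
      fun m => (hC m j k).smul (hF.pd hU m)
    rw [this, pd_sub ((hF.pd hU k).pd hU j) ((s 0).add (s 1)) hU hu]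
    change _ - pd i (fun u => _ + _) u = _
    rw [pd_add (s 0) (s 1) hU hu, pd_smul (hC 0 j k) (hF.pd hU 0) hU hu,
      pd_smul (hC 1 j k) (hF.pd hU 1) hU hu]
  have hs : pd i (pd j (pd k F)) u = pd j (pd i (pd k F)) u := pd_comm (hF.pd hU k) hU hu i j
  have e1 := hn i j k l
  have e2 := hn j i k l
  rw [hd, hs] at e1
  rw [hd] at e2
  have g := fun i j => sum_christoffel_gram hF hU hu (hdet u hu) i j l
  have r0 := hflat 0 k i j
  have r1 := hflat 1 k i j
  simp only [curvature, Fin.sum_univ_two] at r0 r1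
  simp only [Fin.sum_univ_two, gram_apply] at g
  simp only [metric_sub_left, metric_add_left, metric_smul_left, ← g] at e1 e2
  linear_combination e1 - e2 + metric (pd 0 F u) (pd l F u) * r0
    + metric (pd 1 F u) (pd l F u) * r1

end Gauss

/-! ### Null frames -/

/-- A pair of null vectors with product `-1`. -/
structure IsNullPair (e₁ e₂ : ℂ × ℂ) : Prop where
  left : metric e₁ e₁ = 0
  right : metric e₂ e₂ = 0
  cross : metric e₁ e₂ = -1

theorem IsNullPair.symm {e₁ e₂ : ℂ × ℂ} (h : IsNullPair e₁ e₂) : IsNullPair e₂ e₁ :=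
  ⟨h.right, h.left, by rw [metric_comm, h.cross]⟩

theorem IsNullPair.linearIndependent {e₁ e₂ : ℂ × ℂ} (h : IsNullPair e₁ e₂) :
    LinearIndependent ℝ ![e₁, e₂] := by
  rw [LinearIndependent.pair_iff]
  intro s t hst
  have h1 : metric (s • e₁ + t • e₂) e₁ = 0 := by rw [hst, metric_zero_left]
  have h2 : metric (s • e₁ + t • e₂) e₂ = 0 := by rw [hst, metric_zero_left]
  rw [metric_add_left, metric_smul_left, metric_smul_left] at h1 h2
  rw [h.left, metric_comm e₂ e₁, h.cross] at h1
  rw [h.right, h.cross] at h2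
  constructor <;> linarith

theorem IsNullPair.span_eq {e₁ e₂ : ℂ × ℂ} (h : IsNullPair e₁ e₂) {W : Submodule ℝ (ℂ × ℂ)}
    (hW : Module.finrank ℝ W = 2) (h₁ : e₁ ∈ W) (h₂ : e₂ ∈ W) :
    Submodule.span ℝ {e₁, e₂} = W := by
  refine Submodule.eq_of_le_of_finrank_eq ?_ ?_
  · rw [Submodule.span_le]
    rintro x (rfl | rfl)
    exacts [h₁, h₂]
  · rw [hW]
    have := finrank_span_eq_card h.linearIndependent
    rwa [Matrix.range_cons_cons_empty, Fintype.card_fin] at this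

theorem IsNullPair.eq_of_mem {e₁ e₂ : ℂ × ℂ} (h : IsNullPair e₁ e₂) {W : Submodule ℝ (ℂ × ℂ)}
    (hW : Module.finrank ℝ W = 2) (h₁ : e₁ ∈ W) (h₂ : e₂ ∈ W) {T : ℂ × ℂ} (hT : T ∈ W) :
    T = -metric T e₂ • e₁ + -metric T e₁ • e₂ := by
  rw [← h.span_eq hW h₁ h₂, Submodule.mem_span_pair] at hT
  obtain ⟨a, b, rfl⟩ := hT
  simp only [metric_add_left, metric_smul_left, h.left, h.right, h.cross, metric_comm e₂ e₁]
  congr 2 <;> ring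

section Frames

variable {F : E2 → ℂ × ℂ} {U : Set E2} {u : E2}

theorem pd_mem_tangentPlane (F : E2 → ℂ × ℂ) (u : E2) (i : Fin 2) : pd i F u ∈ tangentPlane F u :=
  ⟨_, rfl⟩

theorem metric_fderiv_fderiv (F : E2 → ℂ × ℂ) (u v w : E2) :
    metric (fderiv ℝ F u v) (fderiv ℝ F u w) =
      v 0 * w 0 * gram F u 0 0 + (v 0 * w 1 + v 1 * w 0) * gram F u 0 1
        + v 1 * w 1 * gram F u 1 1 := by
  rw [fderiv_apply_eq_pd F u v, fderiv_apply_eq_pd F u w]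
  simp only [metric_add_left, metric_add_right, metric_smul_left, metric_smul_right, gram_apply]
  rw [metric_comm (pd 1 F u) (pd 0 F u)]
  ring

/-- If `P` has columns `X, Y`, then `Pᵀ g P` is the matrix with zero diagonal and off-diagonal
entries `-1`, which is its own inverse; hence `g⁻¹ = -(X Yᵀ + Y Xᵀ)`. This turns metric traces into
mixed null terms. -/
theorem gram_mul_of_isNullPair {X Y : E2}
    (h : IsNullPair (fderiv ℝ F u X) (fderiv ℝ F u Y)) :
    (Matrix.of fun i j => -(X i * Y j + Y i * X j)) * gram F u = 1 := by
  obtain ⟨h1, h2, h3⟩ := h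
  rw [metric_fderiv_fderiv] at h1 h2 h3
  set g := gram F u
  have hg : g 1 0 = g 0 1 := gram_comm F u 1 0
  let P : Matrix (Fin 2) (Fin 2) ℝ := !![X 0, Y 0; X 1, Y 1]
  let Q : Matrix (Fin 2) (Fin 2) ℝ := !![-Y 0, -Y 1; -X 0, -X 1]
  have hQ : (Q * g) * P = 1 := by
    ext i j
    fin_cases i <;> fin_cases j <;>
      simp [Q, P, Matrix.mul_apply, Matrix.vecMul, dotProduct, Fin.sum_univ_two, hg] <;> linarith
  have hP := mul_eq_one_comm.1 hQ
  rw [← Matrix.mul_assoc] at hP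
  rw [← hP]
  congr 1
  ext i j
  fin_cases i <;> fin_cases j <;> simp [Q, P, Matrix.mul_apply, Fin.sum_univ_two] <;> ring

theorem gram_det_ne_zero_of_isNullPair {X Y : E2}
    (h : IsNullPair (fderiv ℝ F u X) (fderiv ℝ F u Y)) : (gram F u).det ≠ 0 :=
  ((Matrix.isUnit_iff_isUnit_det _).1
    (IsUnit.of_mul_eq_one_right _ (gram_mul_of_isNullPair h))).ne_zero

theorem gram_inv_of_isNullPair {X Y : E2}
    (h : IsNullPair (fderiv ℝ F u X) (fderiv ℝ F u Y)) (i j : Fin 2) :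
    (gram F u)⁻¹ i j = -(X i * Y j + Y i * X j) := by
  rw [Matrix.inv_eq_left_inv (gram_mul_of_isNullPair h)]
  rfl

theorem IsSlantPlane.exists_isNullPair {θ : ℝ} (h : IsSlantPlane θ (tangentPlane F u)) :
    ∃ X Y : E2, IsNullPair (fderiv ℝ F u X) (fderiv ℝ F u Y) := by
  obtain ⟨-, e₁, ⟨X, rfl⟩, e₂, ⟨Y, rfl⟩, h1, h2, h3, -⟩ := h
  exact ⟨X, Y, h1, h2, h3⟩

/-- A smooth null frame near a point. -/
theorem exists_null_frame (hF : ContDiffOn ℝ ∞ F U) (hU : IsOpen U) (hu : u ∈ U) {X Y : E2}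
    (h : IsNullPair (fderiv ℝ F u X) (fderiv ℝ F u Y)) :
    ∃ r > 0, Metric.ball u r ⊆ U ∧ ∃ a b : Fin 2 → E2 → ℝ,
      (∀ i, ContDiffOn ℝ ∞ (a i) (Metric.ball u r)) ∧
      (∀ i, ContDiffOn ℝ ∞ (b i) (Metric.ball u r)) ∧
      ∀ v ∈ Metric.ball u r, IsNullPair (a 0 v • pd 0 F v + a 1 v • pd 1 F v)
        (b 0 v • pd 0 F v + b 1 v • pd 1 F v) := by
  -- The directions `X, Y` are null only at `u`. Their sum is timelike and their difference
  -- spacelike there, with `A = -2`, `B = 0`, `C = 2`.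
  let p : E2 → ℂ × ℂ := fun v => fderiv ℝ F v (X + Y)
  let q : E2 → ℂ × ℂ := fun v => fderiv ℝ F v (X - Y)
  have hp : ContDiffOn ℝ ∞ p U := hF.fderiv_apply_const hU _
  have hq : ContDiffOn ℝ ∞ q U := hF.fderiv_apply_const hU _
  let A : E2 → ℝ := fun v => metric (p v) (p v)
  let B : E2 → ℝ := fun v => metric (p v) (q v)
  let C : E2 → ℝ := fun v => metric (q v) (q v)
  have hA : ContDiffOn ℝ ∞ A U := hp.metric hp
  have hB : ContDiffOn ℝ ∞ B U := hp.metric hq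
  have hC : ContDiffOn ℝ ∞ C U := hq.metric hq
  have hN : ContDiffOn ℝ ∞ (fun v => B v ^ 2 - A v * C v) U := (hB.pow 2).sub (hA.mul hC)
  obtain ⟨h1, h2, h3⟩ := h
  have hA0 : A u < 0 := by
    simp only [A, p, map_add, metric_add_left, metric_add_right, h1, h2, h3,
      metric_comm (fderiv ℝ F u Y) (fderiv ℝ F u X)]
    norm_num
  have hB0 : B u = 0 := by
    simp only [B, p, q, map_add, map_sub, metric_add_left, metric_sub_right, h1, h2, h3,
      metric_comm (fderiv ℝ F u Y) (fderiv ℝ F u X)]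
    norm_num
  have hC0 : 0 < C u := by
    simp only [C, q, map_sub, metric_sub_left, metric_sub_right, h1, h2, h3,
      metric_comm (fderiv ℝ F u Y) (fderiv ℝ F u X)]
    norm_num
  have hUn := hU.mem_nhds hu
  have hev : ∀ᶠ v in nhds u, v ∈ U ∧ A v < 0 ∧ 0 < B v ^ 2 - A v * C v := by
    refine Filter.Eventually.and hUn (Filter.Eventually.and ?_ ?_)
    · exact (hA.continuousOn.continuousAt hUn).eventually_lt continuousAt_const hA0
    · refine continuousAt_const.eventually_lt (hN.continuousOn.continuousAt hUn) ?_
      rw [hB0]; nlinarith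
  obtain ⟨r, hr, hball⟩ := Metric.eventually_nhds_iff_ball.1 hev
  have hrU : Metric.ball u r ⊆ U := fun v hv => (hball v hv).1
  let D : E2 → ℝ := fun v => √(B v ^ 2 - A v * C v)
  have hD : ContDiffOn ℝ ∞ D (Metric.ball u r) :=
    (hN.mono hrU).sqrt fun v hv => (hball v hv).2.2.ne'
  -- `s` and `t` are the roots of `A z² + 2 B z + C`, so `s p + q` and `t p + q` are null. Their
  -- product is `-2 (B² - A C) / A`, which the factor `n` normalizes to `-1`.
  let s : E2 → ℝ := fun v => (-B v + D v) / A v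
  let t : E2 → ℝ := fun v => (-B v - D v) / A v
  let n : E2 → ℝ := fun v => A v / (2 * (B v ^ 2 - A v * C v))
  have hs : ContDiffOn ℝ ∞ s (Metric.ball u r) :=
    ((hB.mono hrU).neg.add hD).div (hA.mono hrU) fun v hv => (hball v hv).2.1.ne
  have ht : ContDiffOn ℝ ∞ t (Metric.ball u r) :=
    ((hB.mono hrU).neg.sub hD).div (hA.mono hrU) fun v hv => (hball v hv).2.1.ne
  have hn : ContDiffOn ℝ ∞ n (Metric.ball u r) :=
    (hA.mono hrU).div (contDiffOn_const.mul (hN.mono hrU)) fun v hv =>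
      mul_ne_zero two_ne_zero (hball v hv).2.2.ne'
  refine ⟨r, hr, hrU, fun i v => s v * (X + Y) i + (X - Y) i,
    fun i v => n v * (t v * (X + Y) i + (X - Y) i),
    fun i => (hs.mul contDiffOn_const).add contDiffOn_const,
    fun i => hn.mul ((ht.mul contDiffOn_const).add contDiffOn_const), fun v hv => ?_⟩
  obtain ⟨-, hAv, hNv⟩ := hball v hv
  have e1 : (s v * (X + Y) 0 + (X - Y) 0) • pd 0 F v + (s v * (X + Y) 1 + (X - Y) 1) • pd 1 F v =
      s v • p v + q v := by
    simp only [p, q]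
    rw [fderiv_apply_eq_pd F v (X + Y), fderiv_apply_eq_pd F v (X - Y)]
    module
  have e2 : (n v * (t v * (X + Y) 0 + (X - Y) 0)) • pd 0 F v +
      (n v * (t v * (X + Y) 1 + (X - Y) 1)) • pd 1 F v = n v • (t v • p v + q v) := by
    simp only [p, q]
    rw [fderiv_apply_eq_pd F v (X + Y), fderiv_apply_eq_pd F v (X - Y)]
    module
  have hDv : D v ^ 2 = B v ^ 2 - A v * C v := Real.sq_sqrt hNv.le
  have hsA : s v * A v = -B v + D v := div_mul_cancel₀ _ hAv.ne
  have htA : t v * A v = -B v - D v := div_mul_cancel₀ _ hAv.ne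
  have hnA : n v * (2 * (B v ^ 2 - A v * C v)) = A v :=
    div_mul_cancel₀ _ (mul_pos two_pos hNv).ne'
  simp only [e1, e2]
  have hm : ∀ x y : ℝ, metric (x • p v + q v) (y • p v + q v) =
      x * y * A v + (x + y) * B v + C v := by
    intro x y
    simp only [metric_add_left, metric_add_right, metric_smul_left, metric_smul_right,
      metric_comm (q v) (p v), A, B, C]
    ring
  refine ⟨?_, ?_, ?_⟩
  · rw [hm]
    refine mul_left_cancel₀ hAv.ne ?_
    linear_combination (s v * A v + D v + B v) * hsA + hDv
  · rw [metric_smul_left, metric_smul_right, hm]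
    have : t v * t v * A v + (t v + t v) * B v + C v = 0 := by
      refine mul_left_cancel₀ hAv.ne ?_
      linear_combination (t v * A v - D v + B v) * htA + hDv
    rw [this]; ring
  · rw [metric_smul_right, hm]
    refine mul_left_cancel₀ hAv.ne ?_
    linear_combination (n v * t v * A v + n v * B v) * hsA + (n v * D v) * htA
      - n v * hDv - hnA

end Frames

/-! ### Null coordinates on flat surfaces -/

section NullCoordinates

variable {F : E2 → ℂ × ℂ} {U : Set E2} {u : E2}

theorem metric_secondForm_of_mem (hF : ContDiffOn ℝ ∞ F U) (hU : IsOpen U) (hu : u ∈ U)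
    (hdet : (gram F u).det ≠ 0) (i j : Fin 2) {T : ℂ × ℂ} (hT : T ∈ tangentPlane F u) :
    metric (secondForm F i j u) T = 0 := by
  obtain ⟨v, rfl⟩ := hT
  change metric _ (fderiv ℝ F u v) = 0
  rw [fderiv_apply_eq_pd F u v, metric_add_right, metric_smul_right, metric_smul_right,
    metric_secondForm_pd hF hU hu hdet, metric_secondForm_pd hF hU hu hdet]
  ring

/-- A tangential field with prescribed components. -/
def tangentField (F : E2 → ℂ × ℂ) (a : Fin 2 → E2 → ℝ) (u : E2) : ℂ × ℂ :=
  a 0 u • pd 0 F u + a 1 u • pd 1 F u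

theorem tangentField_mem (F : E2 → ℂ × ℂ) (a : Fin 2 → E2 → ℝ) (u : E2) :
    tangentField F a u ∈ tangentPlane F u :=
  add_mem (Submodule.smul_mem _ _ (pd_mem_tangentPlane F u 0))
    (Submodule.smul_mem _ _ (pd_mem_tangentPlane F u 1))

theorem contDiffOn_tangentField (hF : ContDiffOn ℝ ∞ F U) (hU : IsOpen U) {a : Fin 2 → E2 → ℝ}
    (ha : ∀ i, ContDiffOn ℝ ∞ (a i) U) : ContDiffOn ℝ ∞ (tangentField F a) U :=
  ((ha 0).smul (hF.pd hU 0)).add ((ha 1).smul (hF.pd hU 1))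

/-- Gauss's formula for a tangential field. The tangential part may stay unspecified, since null
pairs recover it from inner products. -/
theorem pd_tangentField (hF : ContDiffOn ℝ ∞ F U) (hU : IsOpen U) {a : Fin 2 → E2 → ℝ}
    (ha : ∀ i, ContDiffOn ℝ ∞ (a i) U) (hu : u ∈ U) (i : Fin 2) :
    ∃ T ∈ tangentPlane F u, pd i (tangentField F a) u =
      T + (a 0 u • secondForm F i 0 u + a 1 u • secondForm F i 1 u) := by
  have h : pd i (tangentField F a) u = (pd i (a 0) u • pd 0 F u + a 0 u • pd i (pd 0 F) u) +
      (pd i (a 1) u • pd 1 F u + a 1 u • pd i (pd 1 F) u) := by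
    rw [← pd_smul (ha 0) (hF.pd hU 0) hU hu, ← pd_smul (ha 1) (hF.pd hU 1) hU hu]
    exact pd_add ((ha 0).smul (hF.pd hU 0)) ((ha 1).smul (hF.pd hU 1)) hU hu i
  have m := fun i => pd_mem_tangentPlane F u i
  have hs : ∀ (c : ℝ) i, c • pd i F u ∈ tangentPlane F u := fun c i =>
    Submodule.smul_mem _ _ (m i)
  refine ⟨(pd i (a 0) u • pd 0 F u + a 0 u • (christoffel F 0 i 0 u • pd 0 F u +
    christoffel F 1 i 0 u • pd 1 F u)) + (pd i (a 1) u • pd 1 F u +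
    a 1 u • (christoffel F 0 i 1 u • pd 0 F u + christoffel F 1 i 1 u • pd 1 F u)), ?_, ?_⟩
  · exact add_mem (add_mem (hs _ _) (Submodule.smul_mem _ _ (add_mem (hs _ _) (hs _ _))))
      (add_mem (hs _ _) (Submodule.smul_mem _ _ (add_mem (hs _ _) (hs _ _))))
  · rw [h, pd_pd_eq F i 0, pd_pd_eq F i 1]
    module

/-- The Poincaré lemma on a convex set; the primitive is smooth because its differential is. -/
theorem exists_primitive (hU : IsOpen U) (hc : Convex ℝ U) {w : Fin 2 → E2 → ℝ}
    (hw : ∀ i, ContDiffOn ℝ ∞ (w i) U)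
    (hsymm : ∀ i j, ∀ u ∈ U, pd j (w i) u = pd i (w j) u) :
    ∃ f : E2 → ℝ, ContDiffOn ℝ ∞ f U ∧ ∀ u ∈ U, ∀ i, pd i f u = w i u := by
  let p : Fin 2 → E2 →L[ℝ] ℝ := fun i => EuclideanSpace.proj i
  let η : E2 → E2 →L[ℝ] ℝ := fun u => w 0 u • p 0 + w 1 u • p 1
  have hη : ContDiffOn ℝ ∞ η U :=
    ((hw 0).smul contDiffOn_const).add ((hw 1).smul contDiffOn_const)
  obtain ⟨f, hf⟩ := hc.exists_forall_hasFDerivAt_of_fderiv_symmetric hU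
    (fun u hu => (hη.differentiableAt_of_isOpen hU hu).differentiableWithinAt) (by
      intro u hu x y
      have hd := fun i => (hw i).differentiableAt_of_isOpen hU hu
      have key : ∀ x y : E2, fderiv ℝ η u x y = fderiv ℝ (w 0) u x * y 0 +
          fderiv ℝ (w 1) u x * y 1 := by
        intro x y
        have h : HasFDerivAt η _ u := ((hd 0).hasFDerivAt.smul_const (p 0)).add
          ((hd 1).hasFDerivAt.smul_const (p 1))
        rw [h.fderiv]
        simp [p]
      rw [key, key]
      simp only [fderiv_apply_eq_pd (w _), smul_eq_mul]
      rw [hsymm 0 1 u hu]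
      ring)
  refine ⟨f, ?_, ?_⟩
  · rw [contDiffOn_infty_iff_fderiv_of_isOpen hU]
    exact ⟨fun u hu => (hf u hu).differentiableAt.differentiableWithinAt,
      hη.congr fun u hu => (hf u hu).fderiv⟩
  · intro u hu i
    rw [pd, (hf u hu).fderiv]
    fin_cases i <;> simp [η, p]

/-- The connection form of a null frame on a flat surface is closed. -/
theorem connection_form_closed (hF : ContDiffOn ℝ ∞ F U) (hU : IsOpen U)
    (hdet : ∀ u ∈ U, (gram F u).det ≠ 0)
    (hrank : ∀ u ∈ U, Module.finrank ℝ (tangentPlane F u) = 2)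
    (hflat : ∀ u ∈ U, ∀ l k i j, curvature F l k i j u = 0) {a b : Fin 2 → E2 → ℝ}
    (ha : ∀ i, ContDiffOn ℝ ∞ (a i) U) (hb : ∀ i, ContDiffOn ℝ ∞ (b i) U)
    (hab : ∀ u ∈ U, IsNullPair (tangentField F a u) (tangentField F b u)) (i j : Fin 2)
    (hu : u ∈ U) :
    pd j (fun u => metric (pd i (tangentField F a) u) (tangentField F b u)) u =
      pd i (fun u => metric (pd j (tangentField F a) u) (tangentField F b u)) u := by
  have hA := contDiffOn_tangentField hF hU ha
  have hB := contDiffOn_tangentField hF hU hb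
  rw [pd_metric (hA.pd hU i) hB hU hu, pd_metric (hA.pd hU j) hB hU hu, pd_comm hA hU hu i j]
  have hz : ∀ (f : E2 → ℝ) (c : ℝ), (∀ u ∈ U, f u = c) → ∀ i, pd i f u = 0 := by
    intro f c hf i
    rw [pd_congr (g := fun _ => c) hf hU hu]
    simp [pd]
  have hAA : ∀ i, metric (pd i (tangentField F a) u) (tangentField F a u) = 0 := by
    intro i
    have := hz _ _ (fun u hu => (hab u hu).left) i
    rw [pd_metric hA hA hU hu, metric_comm (tangentField F a u)] at this
    linarith
  have hBB : ∀ i, metric (pd i (tangentField F b) u) (tangentField F b u) = 0 := by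
    intro i
    have := hz _ _ (fun u hu => (hab u hu).right) i
    rw [pd_metric hB hB hU hu, metric_comm (tangentField F b u)] at this
    linarith
  have hAB : ∀ i, metric (pd i (tangentField F a) u) (tangentField F b u) =
      -metric (pd i (tangentField F b) u) (tangentField F a u) := by
    intro i
    have := hz _ _ (fun u hu => (hab u hu).cross) i
    rw [pd_metric hA hB hU hu, metric_comm (tangentField F a u)] at this
    linarith
  choose T hT hTa using fun i => pd_tangentField hF hU ha hu i
  choose S hS hSb using fun i => pd_tangentField hF hU hb hu i
  have hn : ∀ i (x y : ℝ) {Z}, Z ∈ tangentPlane F u →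
      metric (x • secondForm F i 0 u + y • secondForm F i 1 u) Z = 0 := by
    intro i x y Z hZ
    rw [metric_add_left, metric_smul_left, metric_smul_left,
      metric_secondForm_of_mem hF hU hu (hdet u hu) _ _ hZ,
      metric_secondForm_of_mem hF hU hu (hdet u hu) _ _ hZ]
    ring
  have ma := tangentField_mem F a u
  have mb := tangentField_mem F b u
  have hTe : ∀ i, T i = -metric (pd i (tangentField F a) u) (tangentField F b u) •
      tangentField F a u := by
    intro i
    have h1 := (hab u hu).eq_of_mem (hrank u hu) ma mb (hT i)
    have h2 := hAA i
    rw [hTa i, metric_add_left, hn i _ _ ma, add_zero] at h2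
    rw [hTa i, metric_add_left, hn i _ _ mb, add_zero]
    rw [h2] at h1
    simpa using h1
  have hSe : ∀ i, S i = metric (pd i (tangentField F a) u) (tangentField F b u) •
      tangentField F b u := by
    intro i
    have h1 := (hab u hu).eq_of_mem (hrank u hu) ma mb (hS i)
    have h2 := hBB i
    rw [hSb i, metric_add_left, hn i _ _ mb, add_zero] at h2
    rw [hAB i, hSb i, metric_add_left, hn i _ _ ma, add_zero]
    rw [h2] at h1
    simpa using h1
  -- With `ωᵢ = ⟨∂ᵢA, B⟩`, the tangential parts of `∂ᵢA` and `∂ᵢB` are `-ωᵢ A` and `ωᵢ B`. The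
  -- exterior derivative of `ω` is the antisymmetrization of `⟨∂ᵢA, ∂ⱼB⟩`: the term `ωᵢωⱼ` is
  -- symmetric, and so is the normal term by the Gauss equation.
  have hprod : ∀ i j, metric (pd i (tangentField F a) u) (pd j (tangentField F b) u) =
      metric (pd i (tangentField F a) u) (tangentField F b u) *
      metric (pd j (tangentField F a) u) (tangentField F b u) +
      metric (a 0 u • secondForm F i 0 u + a 1 u • secondForm F i 1 u)
        (b 0 u • secondForm F j 0 u + b 1 u • secondForm F j 1 u) := by
    intro i j
    conv_lhs => rw [hTa i, hSb j]
    rw [metric_add_left, metric_add_right _ (S j), metric_add_right _ (S j), hn i _ _ (hS j),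
      metric_comm (T i), metric_comm (T i), hn j _ _ (hT i), hTe i, hSe j, metric_smul_left,
      metric_smul_right, (hab u hu).symm.cross]
    ring
  have hg := gauss_equation hF hU hdet hu (hflat u hu)
  rw [hprod i j, hprod j i]
  simp only [metric_add_left, metric_add_right, metric_smul_left, metric_smul_right]
  rw [hg j i 0 0, hg j i 0 1, hg j i 1 0, hg j i 1 1]
  ring

/-- Scaling the frame by `exp ρ` and `exp (-ρ)`, with `dρ` the connection form, makes all
derivatives of `A` and `B` normal. Hence `⟨B, dF⟩` and `⟨A, dF⟩` are closed; their primitives are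
`x` and `y`, and the metric follows from `T = -⟨T, B⟩ A - ⟨T, A⟩ B`. -/
theorem exists_null_coordinates (hF : ContDiffOn ℝ ∞ F U) (hU : IsOpen U)
    (hdet : ∀ u ∈ U, (gram F u).det ≠ 0)
    (hrank : ∀ u ∈ U, Module.finrank ℝ (tangentPlane F u) = 2)
    (hflat : ∀ u ∈ U, ∀ l k i j, curvature F l k i j u = 0)
    (hu : u ∈ U) {X Y : E2} (h : IsNullPair (fderiv ℝ F u X) (fderiv ℝ F u Y)) :
    ∃ V ⊆ U, IsOpen V ∧ u ∈ V ∧ ∃ χ : E2 → ℝ × ℝ, ContDiffOn ℝ ∞ χ V ∧ ∀ u ∈ V, ∀ v w : E2,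
      metric (fderiv ℝ F u v) (fderiv ℝ F u w) =
        -((fderiv ℝ χ u v).1 * (fderiv ℝ χ u w).2) - (fderiv ℝ χ u v).2 * (fderiv ℝ χ u w).1 := by
  obtain ⟨r, hr, hrU, a, b, ha, hb, hab⟩ := exists_null_frame hF hU hu h
  set V := Metric.ball u r
  have hV : IsOpen V := Metric.isOpen_ball
  have hVc : Convex ℝ V := convex_ball u r
  replace hF := hF.mono hrU
  have hdet' := fun v (hv : v ∈ V) => hdet v (hrU hv)
  have hrank' := fun v (hv : v ∈ V) => hrank v (hrU hv)
  have hflat' := fun v (hv : v ∈ V) => hflat v (hrU hv)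
  have hA := contDiffOn_tangentField hF hV ha
  have hB := contDiffOn_tangentField hF hV hb
  obtain ⟨ρ, hρ, hρd⟩ := exists_primitive hV hVc (fun i => (hA.pd hV i).metric hB)
    (fun i j v hv => connection_form_closed hF hV hdet' hrank' hflat' ha hb hab i j hv)
  let A : E2 → ℂ × ℂ := fun v => Real.exp (ρ v) • tangentField F a v
  let B : E2 → ℂ × ℂ := fun v => Real.exp (-ρ v) • tangentField F b v
  have hexp : ContDiffOn ℝ ∞ (fun v => Real.exp (ρ v)) V := hρ.exp
  have hexpn : ContDiffOn ℝ ∞ (fun v => Real.exp (-ρ v)) V := hρ.neg.exp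
  have hA' : ContDiffOn ℝ ∞ A V := hexp.smul hA
  have hB' : ContDiffOn ℝ ∞ B V := hexpn.smul hB
  have hprod : ∀ v, Real.exp (ρ v) * Real.exp (-ρ v) = 1 := fun v => by
    rw [← Real.exp_add, add_neg_cancel, Real.exp_zero]
  have hAB : ∀ v ∈ V, IsNullPair (A v) (B v) := by
    intro v hv
    obtain ⟨h1, h2, h3⟩ := hab v hv
    change metric (tangentField F a v) (tangentField F a v) = 0 at h1
    change metric (tangentField F b v) (tangentField F b v) = 0 at h2
    change metric (tangentField F a v) (tangentField F b v) = -1 at h3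
    refine ⟨?_, ?_, ?_⟩ <;> simp only [A, B, metric_smul_left, metric_smul_right, h1, h2, h3]
    · ring
    · ring
    · linear_combination -hprod v
  have mA : ∀ v, A v ∈ tangentPlane F v := fun v => Submodule.smul_mem _ _ (tangentField_mem F a v)
  have mB : ∀ v, B v ∈ tangentPlane F v := fun v => Submodule.smul_mem _ _ (tangentField_mem F b v)
  have hz : ∀ (f : E2 → ℝ) (c : ℝ), (∀ u ∈ V, f u = c) → ∀ v ∈ V, ∀ i, pd i f v = 0 := by
    intro f c hf v hv i
    rw [pd_congr (g := fun _ => c) hf hV hv]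
    simp [pd]
  have dAB : ∀ v ∈ V, ∀ i, metric (pd i A v) (B v) = 0 := by
    intro v hv i
    have he : pd i (fun v => Real.exp (ρ v)) v = Real.exp (ρ v) *
        metric (pd i (tangentField F a) v) (tangentField F b v) := by
      rw [← hρd v hv i, pd, fderiv_exp (hρ.differentiableAt_of_isOpen hV hv)]
      simp [pd]
    rw [pd_smul hexp hA hV hv, he]
    have h3 : metric (tangentField F a v) (tangentField F b v) = -1 := (hab v hv).cross
    simp only [B, metric_add_left, metric_smul_left, metric_smul_right, h3]
    ring
  have dBA : ∀ v ∈ V, ∀ i, metric (pd i B v) (A v) = 0 := by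
    intro v hv i
    have := hz _ _ (fun v hv => (hAB v hv).cross) v hv i
    rw [pd_metric hA' hB' hV hv, dAB v hv, metric_comm (A v)] at this
    linarith
  have dAA : ∀ v ∈ V, ∀ i, metric (pd i A v) (A v) = 0 := by
    intro v hv i
    have := hz _ _ (fun v hv => (hAB v hv).left) v hv i
    rw [pd_metric hA' hA' hV hv, metric_comm (A v)] at this
    linarith
  have dBB : ∀ v ∈ V, ∀ i, metric (pd i B v) (B v) = 0 := by
    intro v hv i
    have := hz _ _ (fun v hv => (hAB v hv).right) v hv i
    rw [pd_metric hB' hB' hV hv, metric_comm (B v)] at this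
    linarith
  have expand : ∀ v ∈ V, ∀ {T}, T ∈ tangentPlane F v →
      T = -metric T (B v) • A v + -metric T (A v) • B v := fun v hv T hT =>
    (hAB v hv).eq_of_mem (hrank' v hv) (mA v) (mB v) hT
  have nA : ∀ v ∈ V, ∀ i j, metric (pd i A v) (pd j F v) = 0 := by
    intro v hv i j
    rw [expand v hv (pd_mem_tangentPlane F v j), metric_add_right,
      metric_smul_right _ _ (A v), metric_smul_right _ _ (B v), dAA v hv, dAB v hv]
    ring
  have nB : ∀ v ∈ V, ∀ i j, metric (pd i B v) (pd j F v) = 0 := by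
    intro v hv i j
    rw [expand v hv (pd_mem_tangentPlane F v j), metric_add_right,
      metric_smul_right _ _ (A v), metric_smul_right _ _ (B v), dBA v hv, dBB v hv]
    ring
  obtain ⟨x, hx, hxd⟩ := exists_primitive hV hVc
    (w := fun i v => metric (B v) (pd i F v)) (fun i => hB'.metric (hF.pd hV i))
    (fun i j v hv => by
      rw [pd_metric hB' (hF.pd hV i) hV hv, pd_metric hB' (hF.pd hV j) hV hv, nB v hv, nB v hv,
        pd_comm hF hV hv])
  obtain ⟨y, hy, hyd⟩ := exists_primitive hV hVc
    (w := fun i v => metric (A v) (pd i F v)) (fun i => hA'.metric (hF.pd hV i))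
    (fun i j v hv => by
      rw [pd_metric hA' (hF.pd hV i) hV hv, pd_metric hA' (hF.pd hV j) hV hv, nA v hv, nA v hv,
        pd_comm hF hV hv])
  refine ⟨V, hrU, hV, Metric.mem_ball_self hr, fun v => (x v, y v), hx.prodMk hy, ?_⟩
  intro v hv z w
  have hfx : ∀ z : E2, fderiv ℝ x v z = metric (B v) (fderiv ℝ F v z) := by
    intro z
    rw [fderiv_apply_eq_pd x, fderiv_apply_eq_pd F, hxd v hv, hxd v hv]
    simp only [metric_add_right, metric_smul_right, smul_eq_mul]
  have hfy : ∀ z : E2, fderiv ℝ y v z = metric (A v) (fderiv ℝ F v z) := by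
    intro z
    rw [fderiv_apply_eq_pd y, fderiv_apply_eq_pd F, hyd v hv, hyd v hv]
    simp only [metric_add_right, metric_smul_right, smul_eq_mul]
  have hχ : ∀ z : E2, fderiv ℝ (fun v => (x v, y v)) v z =
      (metric (B v) (fderiv ℝ F v z), metric (A v) (fderiv ℝ F v z)) := by
    intro z
    rw [← hfx, ← hfy, (hx.differentiableAt_of_isOpen hV hv).fderiv_prodMk
      (hy.differentiableAt_of_isOpen hV hv)]
    rfl
  rw [hχ, hχ]
  have hm : fderiv ℝ F v z ∈ tangentPlane F v := ⟨z, rfl⟩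
  conv_lhs => rw [expand v hv hm]
  rw [metric_add_left, metric_smul_left _ (A v), metric_smul_left _ (B v), metric_comm _ (B v),
    metric_comm _ (A v)]
  ring

end NullCoordinates

/-! ### Existence of null rectangles -/

section Existence

variable {M : Type*} [TopologicalSpace M] [ChartedSpace E2 M] {L : M → ℂ × ℂ} {θ : ℝ}

theorem IsLorentzianSurface.contDiffOn_chart [IsManifold (𝓡 2) ∞ M] (hL : IsLorentzianSurface L)
    {e : OpenPartialHomeomorph M E2} (he : e ∈ atlas E2 M) :
    ContDiffOn ℝ ∞ (L ∘ e.symm) e.target :=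
  contMDiffOn_iff_contDiffOn.1 (hL.smooth.comp_contMDiffOn
    (contMDiffOn_symm_of_mem_maximalAtlas (IsManifold.subset_maximalAtlas he)))

theorem IsSlant.gram_det_ne_zero (h : IsSlant θ L) {e : OpenPartialHomeomorph M E2}
    (he : e ∈ atlas E2 M) {u : E2} (hu : u ∈ e.target) : (gram (L ∘ e.symm) u).det ≠ 0 := by
  obtain ⟨X, Y, hXY⟩ := (h e he u hu).exists_isNullPair
  exact gram_det_ne_zero_of_isNullPair hXY

theorem exists_box_subset {U : Set (ℝ × ℝ)} (hU : IsOpen U) {q : ℝ × ℝ} (hq : q ∈ U) :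
    ∃ I K : Set ℝ, IsOpen I ∧ I.OrdConnected ∧ IsOpen K ∧ K.OrdConnected ∧ q ∈ I ×ˢ K ∧
      I ×ˢ K ⊆ U := by
  obtain ⟨r, hr, h⟩ := Metric.isOpen_iff.1 hU q hq
  refine ⟨Metric.ball q.1 r, Metric.ball q.2 r, Metric.isOpen_ball,
    (convex_ball _ _).ordConnected, Metric.isOpen_ball, (convex_ball _ _).ordConnected,
    ⟨Metric.mem_ball_self hr, Metric.mem_ball_self hr⟩, ?_⟩
  rwa [ball_prod_same]

theorem injective_fderiv_of_null_coordinates {F : E2 → ℂ × ℂ} {χ : E2 → ℝ × ℝ} {u : E2}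
    {X Y : E2} (hXY : IsNullPair (fderiv ℝ F u X) (fderiv ℝ F u Y))
    (h : ∀ v w : E2, metric (fderiv ℝ F u v) (fderiv ℝ F u w) =
      -((fderiv ℝ χ u v).1 * (fderiv ℝ χ u w).2) - (fderiv ℝ χ u v).2 * (fderiv ℝ χ u w).1) :
    Function.Injective (fderiv ℝ χ u : E2 →ₗ[ℝ] ℝ × ℝ) := by
  have hinj : ∀ x : ℝ × ℝ, (∃ v, fderiv ℝ χ u v = x) := by
    let g : E2 →ₗ[ℝ] ℝ × ℝ := fderiv ℝ χ u
    have h1 := h X X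
    have h2 := h Y Y
    have h3 := h X Y
    rw [hXY.left] at h1
    rw [hXY.right] at h2
    rw [hXY.cross] at h3
    set x := fderiv ℝ χ u X
    set y := fderiv ℝ χ u Y
    have hd : (x.1 * y.2 - x.2 * y.1) ^ 2 = 1 := by
      have hx : x.1 * x.2 = 0 := by linarith
      have hs : x.1 * y.2 + x.2 * y.1 = 1 := by linarith
      linear_combination (x.1 * y.2 + x.2 * y.1 + 1) * hs - 4 * y.1 * y.2 * hx
    set d := x.1 * y.2 - x.2 * y.1
    intro z
    -- Cramer's rule; since `d² = 1`, multiplying by `d` replaces dividing by it.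
    refine ⟨(d * (z.1 * y.2 - z.2 * y.1)) • X + (d * (x.1 * z.2 - x.2 * z.1)) • Y, ?_⟩
    rw [map_add, map_smul, map_smul]
    change _ • x + _ • y = z
    ext
    · simp only [Prod.fst_add, Prod.smul_fst, smul_eq_mul]
      simp only [d] at hd ⊢
      linear_combination z.1 * hd
    · simp only [Prod.snd_add, Prod.smul_snd, smul_eq_mul]
      simp only [d] at hd ⊢
      linear_combination z.2 * hd
  exact (LinearMap.injective_iff_surjective_of_finrank_eq_finrank (by simp)).2 hinj

/-- The inverse function theorem applied to null coordinates, followed by the inverse chart.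
Openness of the image serves the gluing of planes in the totally geodesic case. -/
theorem exists_isNullRectangle [IsManifold (𝓡 2) ∞ M] (hL : IsLorentzianSurface L)
    (hflat : IsFlat L) (hslant : IsSlant θ L) (p : M) :
    ∃ (I K : Set ℝ) (φ : ℝ × ℝ → M), IsNullRectangle L I K φ ∧ Set.InjOn φ (I ×ˢ K) ∧
      p ∈ φ '' (I ×ˢ K) ∧ IsOpen (φ '' (I ×ˢ K)) := by
  let e := chartAt E2 p
  have he : e ∈ atlas E2 M := chart_mem_atlas E2 p
  have hpe : p ∈ e.source := mem_chart_source E2 p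
  set F := L ∘ e.symm
  have hF : ContDiffOn ℝ ∞ F e.target := hL.contDiffOn_chart he
  have hu : e p ∈ e.target := e.map_source hpe
  obtain ⟨X, Y, hXY⟩ := (hslant e he _ hu).exists_isNullPair
  obtain ⟨V, hVU, hV, huV, χ, hχ, hχm⟩ := exists_null_coordinates hF e.open_target
    (fun u hu => hslant.gram_det_ne_zero he hu) (fun u hu => (hslant e he u hu).1.1)
    (fun u hu => hflat e he u hu) hu hXY
  have hequiv : ∀ v ∈ V, ∃ χ' : E2 ≃L[ℝ] ℝ × ℝ, HasFDerivAt χ (χ' : E2 →L[ℝ] ℝ × ℝ) v := by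
    intro v hv
    obtain ⟨X, Y, hXY⟩ := (hslant e he _ (hVU hv)).exists_isNullPair
    have hinj := injective_fderiv_of_null_coordinates hXY (hχm v hv)
    refine ⟨(LinearEquiv.ofInjectiveOfFinrankEq _ hinj (by simp)).toContinuousLinearEquiv, ?_⟩
    exact (hχ.differentiableAt_of_isOpen hV hv).hasFDerivAt.congr_fderiv
      (ContinuousLinearMap.ext fun x => rfl)
  have hχc : ∀ v ∈ V, ContDiffAt ℝ ∞ χ v := fun v hv => hχ.contDiffAt (hV.mem_nhds hv)
  obtain ⟨χ', hχ'⟩ := hequiv _ huV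
  let R := ((hχc _ huV).toOpenPartialHomeomorph χ hχ' (by simp)).restrOpen V hV
  have hRc : ⇑R = χ := rfl
  have hRV : ∀ v ∈ R.source, v ∈ V := fun v hv => hv.2
  have hRu : e p ∈ R.source :=
    ⟨(hχc _ huV).mem_toOpenPartialHomeomorph_source hχ' (by simp), huV⟩
  obtain ⟨I, K, hI, hIo, hK, hKo, hq, hIK⟩ := exists_box_subset R.open_target (R.map_source hRu)
  have hsV : ∀ q ∈ I ×ˢ K, R.symm q ∈ V := fun q hq => hRV _ (R.map_target (hIK hq))
  have hsymm : ∀ q ∈ I ×ˢ K, ContDiffAt ℝ ∞ R.symm q := by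
    intro q hq
    obtain ⟨χ', hχ'⟩ := hequiv _ (hsV q hq)
    exact R.contDiffAt_symm (hIK hq) hχ' (hχc _ (hsV q hq))
  have hst : Set.MapsTo R.symm (I ×ˢ K) e.target := fun q hq => hVU (hsV q hq)
  refine ⟨I, K, e.symm ∘ R.symm, ⟨hI, hIo, hK, hKo, ?_, ?_⟩, ?_, ?_, ?_⟩
  · exact (contMDiffOn_symm_of_mem_maximalAtlas (IsManifold.subset_maximalAtlas he)).comp
      (contMDiffOn_iff_contDiffOn.2 fun q hq => (hsymm q hq).contDiffWithinAt) hst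
  · intro q hq v w
    have hd : DifferentiableAt ℝ R.symm q := (hsymm q hq).differentiableAt (by simp)
    have hFd := hF.differentiableAt_of_isOpen e.open_target (hst hq)
    have h1 : ∀ v, fderiv ℝ (L ∘ e.symm ∘ R.symm) q v =
        fderiv ℝ F (R.symm q) (fderiv ℝ R.symm q v) := by
      intro v
      change fderiv ℝ (F ∘ R.symm) q v = _
      rw [fderiv_comp q hFd hd]
      rfl
    have h2 : ∀ v, fderiv ℝ χ (R.symm q) (fderiv ℝ R.symm q v) = v := by
      intro v
      have : χ ∘ R.symm =ᶠ[nhds q] id := by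
        filter_upwards [R.open_target.mem_nhds (hIK hq)] with x hx using R.right_inv hx
      have h3 := this.fderiv_eq (𝕜 := ℝ)
      rw [fderiv_comp q ((hχc _ (hsV q hq)).differentiableAt (by simp)) hd] at h3
      simpa using congrArg (fun g : ℝ × ℝ →L[ℝ] ℝ × ℝ => g v) h3
    rw [h1, h1, hχm _ (hsV q hq), h2, h2]
  · exact e.symm.injOn.comp (R.symm.injOn.mono hIK) hst
  · refine ⟨R (e p), hq, ?_⟩
    simp only [Function.comp_apply]
    rw [R.left_inv hRu, e.left_inv hpe]
  · rw [Set.image_comp]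
    refine e.isOpen_image_symm_of_subset_target ?_ hst.image_subset
    exact R.isOpen_image_symm_of_subset_target (hI.prod hK) hIK

end Existence

/-! ### Congruence with the model surfaces -/

section Congruence

theorem eq_of_fderiv_fst_eq_zero {V : Type*} [NormedAddCommGroup V] [NormedSpace ℝ V]
    {I K : Set ℝ} (hI : IsOpen I) (hI' : I.OrdConnected) {g : ℝ × ℝ → V}
    (hg : ∀ q ∈ I ×ˢ K, DifferentiableAt ℝ g q) (h0 : ∀ q ∈ I ×ˢ K, fderiv ℝ g q (1, 0) = 0)
    {x x' y : ℝ} (hx : x ∈ I) (hx' : x' ∈ I) (hy : y ∈ K) : g (x, y) = g (x', y) := by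
  have hd : ∀ t ∈ I, HasDerivAt (fun t => g (t, y)) 0 t := by
    intro t ht
    have := (hg (t, y) ⟨ht, hy⟩).hasFDerivAt.comp_hasDerivAt t
      ((hasDerivAt_id t).prodMk (hasDerivAt_const t y))
    rwa [h0 _ ⟨ht, hy⟩] at this
  exact hI.is_const_of_deriv_eq_zero hI'.isPreconnected
    (fun t ht => (hd t ht).differentiableAt.differentiableWithinAt)
    (fun t ht => (hd t ht).deriv) hx hx'

theorem eq_of_fderiv_snd_eq_zero {V : Type*} [NormedAddCommGroup V] [NormedSpace ℝ V]
    {I K : Set ℝ} (hK : IsOpen K) (hK' : K.OrdConnected) {g : ℝ × ℝ → V}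
    (hg : ∀ q ∈ I ×ˢ K, DifferentiableAt ℝ g q) (h0 : ∀ q ∈ I ×ˢ K, fderiv ℝ g q (0, 1) = 0)
    {x y y' : ℝ} (hx : x ∈ I) (hy : y ∈ K) (hy' : y' ∈ K) : g (x, y) = g (x, y') := by
  have hd : ∀ t ∈ K, HasDerivAt (fun t => g (x, t)) 0 t := by
    intro t ht
    have := (hg (x, t) ⟨hx, ht⟩).hasFDerivAt.comp_hasDerivAt t
      ((hasDerivAt_const t x).prodMk (hasDerivAt_id t))
    rwa [h0 _ ⟨hx, ht⟩] at this
  exact hK.is_const_of_deriv_eq_zero hK'.isPreconnected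
    (fun t ht => (hd t ht).differentiableAt.differentiableWithinAt)
    (fun t ht => (hd t ht).deriv) hy hy'

/-! ### Hermitian algebra of null frames. -/

theorem herm_im (z w : ℂ × ℂ) : (herm z w).im = metric (cplxJ z) w := by
  simp [metric, herm, cplxJ]
  ring

theorem herm_self_eq_zero {z : ℂ × ℂ} (h : metric z z = 0) : herm z z = 0 := by
  rw [metric_eq_re_im] at h
  apply Complex.ext
  · rw [← metric.eq_def, metric_eq_re_im, h]; rfl
  · simp [herm]; ring

theorem herm_conj (z w : ℂ × ℂ) : starRingEnd ℂ (herm z w) = herm w z := by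
  simp [herm, mul_comm]

theorem herm_comb (p q p' q' : ℂ) (a b : ℂ × ℂ) :
    herm (p • a + q • b) (p' • a + q' • b) = starRingEnd ℂ p * p' * herm a a +
      starRingEnd ℂ p * q' * herm a b + starRingEnd ℂ q * p' * herm b a +
      starRingEnd ℂ q * q' * herm b b := by
  simp [herm]
  ring

/-- Two null vectors with nonzero Hermitian product form a basis. -/
def frameMap (a b : ℂ × ℂ) : (ℂ × ℂ) →ₗ[ℂ] (ℂ × ℂ) :=
  (LinearMap.toSpanSingleton ℂ _ a).coprod (LinearMap.toSpanSingleton ℂ _ b)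

theorem frameMap_apply (a b z : ℂ × ℂ) : frameMap a b z = z.1 • a + z.2 • b := by
  simp [frameMap]

theorem frameMap_injective {a b : ℂ × ℂ} (ha : herm a a = 0) (hb : herm b b = 0)
    (hab : herm a b ≠ 0) : Function.Injective (frameMap a b) := by
  rw [← LinearMap.ker_eq_bot, LinearMap.ker_eq_bot']
  intro z hz
  rw [frameMap_apply] at hz
  have h1 := herm_comb 1 0 z.1 z.2 a b
  have h2 := herm_comb 0 1 z.1 z.2 a b
  have h0 : ∀ w, herm w (0 : ℂ × ℂ) = 0 := fun w => by simp [herm]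
  rw [hz, h0] at h1 h2
  have hba : herm b a ≠ 0 := by rw [← herm_conj]; simpa using hab
  simp [ha, hb, hab, hba] at h1 h2
  ext1 <;> simp [h1, h2]

/-- A complex linear isometry taking a null frame to another one with the same product. -/
theorem exists_holomorphic_isometry {a b a' b' : ℂ × ℂ} (ha : herm a a = 0) (hb : herm b b = 0)
    (ha' : herm a' a' = 0) (hb' : herm b' b' = 0) (hab : herm a b ≠ 0)
    (h : herm a b = herm a' b') :
    ∃ Λ : (ℂ × ℂ) ≃ₗ[ℂ] (ℂ × ℂ), Λ a = a' ∧ Λ b = b' ∧ ∀ z w, herm (Λ z) (Λ w) = herm z w := by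
  let S := LinearEquiv.ofInjectiveEndo (frameMap a b) (frameMap_injective ha hb hab)
  let T := LinearEquiv.ofInjectiveEndo (frameMap a' b') (frameMap_injective ha' hb' (h ▸ hab))
  have hS : ∀ z, S z = z.1 • a + z.2 • b := frameMap_apply a b
  have hT : ∀ z, T z = z.1 • a' + z.2 • b' := frameMap_apply a' b'
  have hST : ∀ z, (S.symm.trans T) (S z) = T z := fun z => by simp
  refine ⟨S.symm.trans T, ?_, ?_, ?_⟩
  · have := hST (1, 0)
    rw [hS, hT] at this
    simpa using this
  · have := hST (0, 1)
    rw [hS, hT] at this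
    simpa using this
  · intro z w
    obtain ⟨z, rfl⟩ := S.surjective z
    obtain ⟨w, rfl⟩ := S.surjective w
    rw [hST, hST, hS, hS, hT, hT, herm_comb, herm_comb, ha, hb, ha', hb', ← herm_conj a b,
      ← herm_conj a' b', h]

/-- The nonzero vector `a - a'` is orthogonal to `b` and `b'`, so these are complex proportional;
equal nonzero products with `a` make the factor one. -/
theorem eq_of_herm_eq {a a' b b' : ℂ × ℂ} {κ : ℂ} (hκ : κ ≠ 0) (h1 : herm a b = κ)
    (h2 : herm a b' = κ) (h3 : herm a' b = κ) (h4 : herm a' b' = κ) (hne : a ≠ a') : b = b' := by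
  simp only [herm] at h1 h2 h3 h4
  have hdet : b.1 * b'.2 = b.2 * b'.1 := by
    by_contra hc
    have hc' := sub_ne_zero.2 hc
    apply hne
    have e1 : starRingEnd ℂ a.1 = starRingEnd ℂ a'.1 := by
      apply mul_left_cancel₀ hc'
      linear_combination (h3 - h1) * b'.2 - (h4 - h2) * b.2
    have e2 : starRingEnd ℂ a.2 = starRingEnd ℂ a'.2 := by
      apply mul_left_cancel₀ hc'
      linear_combination (h3 - h1) * b'.1 - (h4 - h2) * b.1
    exact Prod.ext ((starRingEnd ℂ).injective e1) ((starRingEnd ℂ).injective e2)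
  ext1
  · apply mul_left_cancel₀ hκ
    linear_combination -b.1 * h2 + b'.1 * h1 + starRingEnd ℂ a.2 * hdet
  · apply mul_left_cancel₀ hκ
    linear_combination -b.2 * h2 + b'.2 * h1 + starRingEnd ℂ a.1 * hdet

/-- The complementary null vector of the model surface. -/
def modelNormal (θ : ℝ) : ℂ × ℂ :=
  ((Real.cosh θ : ℂ) ^ 2 / 2,
    (Real.cosh θ : ℂ) ^ 2 / 2 - 1 - Complex.I * (Real.sinh θ : ℂ))

theorem herm_one_one : herm (1, 1) (1, 1) = 0 := by simp [herm]

theorem herm_one_modelNormal (θ : ℝ) :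
    herm (1, 1) (modelNormal θ) = -1 - Complex.I * (Real.sinh θ : ℂ) := by
  simp [herm, modelNormal]
  ring

theorem herm_modelNormal (θ : ℝ) : herm (modelNormal θ) (modelNormal θ) = 0 := by
  have h : (Real.cosh θ : ℂ) ^ 2 = (Real.sinh θ : ℂ) ^ 2 + 1 := by
    rw [← Complex.ofReal_pow, Real.cosh_sq θ]; push_cast; rfl
  simp only [herm, modelNormal, map_sub, map_mul, map_div₀, map_pow, Complex.conj_ofReal, map_one,
    Complex.conj_I, map_ofNat]
  linear_combination -h - Real.sinh θ ^ 2 * Complex.I_sq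

theorem model_eq (θ : ℝ) (f : ℝ → ℝ) (q : ℝ × ℝ) :
    model θ f q = q.1 • ((1, 1) : ℂ × ℂ) + q.2 • modelNormal θ +
      f q.2 • ((Complex.I - (Real.sinh θ : ℂ)) • ((1, 1) : ℂ × ℂ)) := by
  ext1
  · simp [model, modelNormal]; ring
  · simp [model, modelNormal]; ring

/-- The product with `(1, 1)` determines `m.2 - m.1`, after which the quadratic terms of the null
condition cancel and a real line remains. Its parameter is `m.1.im`, because `modelNormal` has real
first coordinate and that of the direction has imaginary part one. -/
theorem exists_real_of_null (θ : ℝ) {m : ℂ × ℂ} (hm : herm m m = 0)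
    (h1 : herm (1, 1) m = -1 - Complex.I * (Real.sinh θ : ℂ)) :
    m = modelNormal θ + m.1.im • ((Complex.I - (Real.sinh θ : ℂ)) • ((1, 1) : ℂ × ℂ)) := by
  have h := congrArg Complex.re hm
  have h2 := congrArg Complex.re h1
  have h3 := congrArg Complex.im h1
  have hc := Real.cosh_sq θ
  rw [← metric.eq_def, metric_eq_re_im] at h
  simp [herm, -Complex.ofReal_sinh] at h2 h3
  have e2 : m.2.re = m.1.re - 1 := by linarith
  have e3 : m.2.im = m.1.im - Real.sinh θ := by linarith
  rw [e2, e3] at h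
  simp at h
  have e1 : m.1.re = Real.cosh θ ^ 2 / 2 - Real.sinh θ * m.1.im := by
    rw [hc]; nlinarith
  have hre : ((Real.cosh θ : ℂ) ^ 2).re = Real.cosh θ ^ 2 := by
    rw [← Complex.ofReal_pow, Complex.ofReal_re]
  have him : ((Real.cosh θ : ℂ) ^ 2).im = 0 := by
    rw [← Complex.ofReal_pow, Complex.ofReal_im]
  ext1 <;> apply Complex.ext <;>
    simp [modelNormal, e2, e3, e1, hre, him, -Complex.ofReal_sinh, -Complex.ofReal_cosh] <;> ring

theorem isMotion_of_holomorphic {Λ : (ℂ × ℂ) ≃ₗ[ℂ] (ℂ × ℂ)}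
    (h : ∀ z w, herm (Λ z) (Λ w) = herm z w) (v : ℂ × ℂ) :
    IsMotion (((Λ.restrictScalars ℝ).toAffineEquiv).trans (AffineEquiv.constVAdd ℝ _ v)) := by
  refine ⟨fun z w => ?_, Or.inl fun z => ?_⟩
  · change (herm (Λ z) (Λ w)).re = _
    rw [h]; rfl
  · exact Λ.map_smul Complex.I z

/-- After an isometry taking `a` to `(1, 1)`, subtracting the linear part `P` leaves an error `E`
that does not depend on `x` and whose `y`-derivative is a real multiple of `c`. So `E` is a constant
plus `f(y) c`. -/
theorem congruentToModel_of_const {θ : ℝ} {G : ℝ × ℝ → ℂ × ℂ} {I K : Set ℝ} (hI : IsOpen I)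
    (hI' : I.OrdConnected) (hK : IsOpen K) (hK' : K.OrdConnected)
    (hG : ContDiffOn ℝ ∞ G (I ×ˢ K)) {a : ℂ × ℂ}
    (ha : ∀ q ∈ I ×ˢ K, fderiv ℝ G q (1, 0) = a) (haa : herm a a = 0)
    (hnull : ∀ q ∈ I ×ˢ K, herm (fderiv ℝ G q (0, 1)) (fderiv ℝ G q (0, 1)) = 0)
    (hab : ∀ q ∈ I ×ˢ K, herm a (fderiv ℝ G q (0, 1)) = -1 - Complex.I * (Real.sinh θ : ℂ)) :
    CongruentToModel θ G I K := by
  have hR : IsOpen (I ×ˢ K) := hI.prod hK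
  -- The intervals of a null rectangle may be empty.
  rcases (I ×ˢ K).eq_empty_or_nonempty with he | ⟨q₀, hq₀⟩
  · refine ⟨fun _ => 0, contDiffOn_const, AffineEquiv.refl ℝ _,
      ⟨fun z w => rfl, Or.inl fun z => rfl⟩, fun q hq => ?_⟩
    rw [he] at hq
    exact hq.elim
  have hκ : herm (1, 1) (modelNormal θ) ≠ 0 := by
    rw [herm_one_modelNormal]
    intro h
    have := congrArg Complex.re h
    simp [-Complex.ofReal_sinh] at this
  obtain ⟨Λ, hΛa, -, hΛ⟩ := exists_holomorphic_isometry herm_one_one (herm_modelNormal θ) haa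
    (hnull q₀ hq₀) hκ ((herm_one_modelNormal θ).trans (hab q₀ hq₀).symm)
  have hΛ' : ∀ z w, herm (Λ.symm z) (Λ.symm w) = herm z w := fun z w => by
    rw [← hΛ, Λ.apply_symm_apply, Λ.apply_symm_apply]
  have hΛa' : Λ.symm a = (1, 1) := by rw [← hΛa, Λ.symm_apply_apply]
  let ℓ : (ℂ × ℂ) →L[ℝ] (ℂ × ℂ) :=
    LinearMap.toContinuousLinearMap (Λ.symm.restrictScalars ℝ).toLinearMap
  let P : ℝ × ℝ →L[ℝ] ℂ × ℂ :=
    (ContinuousLinearMap.toSpanSingleton ℝ ((1, 1) : ℂ × ℂ)).comp (ContinuousLinearMap.fst ℝ ℝ ℝ) +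
    (ContinuousLinearMap.toSpanSingleton ℝ (modelNormal θ)).comp (ContinuousLinearMap.snd ℝ ℝ ℝ)
  have hP : ∀ q, P q = q.1 • ((1, 1) : ℂ × ℂ) + q.2 • modelNormal θ := fun q => by simp [P]
  let c : ℂ × ℂ := (Complex.I - (Real.sinh θ : ℂ)) • ((1, 1) : ℂ × ℂ)
  let E : ℝ × ℝ → ℂ × ℂ := fun q => ℓ (G q) - P q
  have hE : ContDiffOn ℝ ∞ E (I ×ˢ K) :=
    (ℓ.contDiff.comp_contDiffOn hG).sub P.contDiff.contDiffOn
  have hEd : ∀ q ∈ I ×ˢ K, ∀ v, fderiv ℝ E q v = Λ.symm (fderiv ℝ G q v) - P v := by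
    intro q hq v
    have h : HasFDerivAt E (ℓ.comp (fderiv ℝ G q) - P) q :=
      (ℓ.hasFDerivAt.comp q (hG.differentiableAt_of_isOpen hR hq).hasFDerivAt).sub P.hasFDerivAt
    rw [h.fderiv]
    rfl
  have hEx : ∀ q ∈ I ×ˢ K, fderiv ℝ E q (1, 0) = 0 := by
    intro q hq
    rw [hEd q hq, ha q hq, hΛa', hP]
    simp
  have hEy : ∀ q ∈ I ×ˢ K, ∃ t : ℝ, fderiv ℝ E q (0, 1) = t • c := by
    intro q hq
    have := exists_real_of_null θ (m := Λ.symm (fderiv ℝ G q (0, 1)))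
      (by rw [hΛ', hnull q hq]) (by rw [← hΛa', hΛ', hab q hq])
    refine ⟨(Λ.symm (fderiv ℝ G q (0, 1))).1.im, ?_⟩
    rw [hEd q hq, hP, sub_eq_iff_eq_add, zero_smul, zero_add, one_smul, add_comm]
    exact this
  -- The real projection along `c`, whose first coordinate has imaginary part one. Thus `N ∘ E` is
  -- constant, giving the translation, and the removed coefficient is `f`.
  let N : (ℂ × ℂ) →L[ℝ] (ℂ × ℂ) := ContinuousLinearMap.id ℝ _ -
    (ContinuousLinearMap.toSpanSingleton ℝ c).comp
      (Complex.imCLM.comp (ContinuousLinearMap.fst ℝ ℂ ℂ))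
  have hN : ∀ z, N z = z - z.1.im • c := fun z => by simp [N]
  have hNc : ∀ t : ℝ, N (t • c) = 0 := by
    intro t
    rw [hN]
    simp [c, -Complex.ofReal_sinh]
  have hNE : ∀ q ∈ I ×ˢ K, DifferentiableAt ℝ (fun q => N (E q)) q := fun q hq =>
    N.differentiableAt.comp q (hE.differentiableAt_of_isOpen hR hq)
  have hNEd : ∀ q ∈ I ×ˢ K, ∀ v, fderiv ℝ (fun q => N (E q)) q v = N (fderiv ℝ E q v) := by
    intro q hq v
    have h : HasFDerivAt (fun q => N (E q)) (N.comp (fderiv ℝ E q)) q :=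
      N.hasFDerivAt.comp q (hE.differentiableAt_of_isOpen hR hq).hasFDerivAt
    rw [h.fderiv]
    rfl
  have hEc : ∀ q ∈ I ×ˢ K, E q = E (q₀.1, q.2) := fun q hq =>
    eq_of_fderiv_fst_eq_zero hI hI' (fun q hq => hE.differentiableAt_of_isOpen hR hq) hEx
      hq.1 hq₀.1 hq.2
  have hNc : ∀ q ∈ I ×ˢ K, N (E q) = N (E q₀) := by
    intro q hq
    rw [hEc q hq]
    refine eq_of_fderiv_snd_eq_zero hK hK' hNE (fun q hq => ?_) hq₀.1 hq.2 hq₀.2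
    obtain ⟨t, ht⟩ := hEy q hq
    rw [hNEd q hq, ht, hNc]
  refine ⟨fun y => (E (q₀.1, y)).1.im, ?_, _, isMotion_of_holomorphic hΛ (Λ (N (E q₀))), ?_⟩
  · refine (Complex.imCLM.comp (ContinuousLinearMap.fst ℝ ℂ ℂ)).contDiff.comp_contDiffOn
      (hE.comp (contDiffOn_const.prodMk contDiffOn_id) fun y hy => ⟨hq₀.1, hy⟩)
  · intro q hq
    change G q = Λ (N (E q₀)) + Λ _
    rw [← map_add, ← Λ.symm_apply_eq, model_eq, ← hEc q hq, ← hNc q hq, hN, ← hP]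
    change ℓ (G q) = E q - _ + (P q + (E q).1.im • c)
    simp only [E]
    abel

/-- Complex conjugation of both coordinates. -/
def conjEquiv : (ℂ × ℂ) ≃ₗ[ℝ] (ℂ × ℂ) :=
  LinearEquiv.prodCongr Complex.conjAe.toLinearEquiv Complex.conjAe.toLinearEquiv

theorem conjEquiv_apply (z : ℂ × ℂ) :
    conjEquiv z = (starRingEnd ℂ z.1, starRingEnd ℂ z.2) := rfl

theorem conjEquiv_conjEquiv (z : ℂ × ℂ) : conjEquiv (conjEquiv z) = z := by
  simp [conjEquiv_apply]

theorem herm_conjEquiv (z w : ℂ × ℂ) :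
    herm (conjEquiv z) (conjEquiv w) = starRingEnd ℂ (herm z w) := by
  simp [herm, conjEquiv_apply]

theorem conjEquiv_cplxJ (z : ℂ × ℂ) : conjEquiv (cplxJ z) = -cplxJ (conjEquiv z) := by
  ext1 <;> simp [cplxJ, conjEquiv_apply]

theorem IsMotion.trans_conjEquiv {Φ : (ℂ × ℂ) ≃ᵃ[ℝ] (ℂ × ℂ)} (h : IsMotion Φ) :
    IsMotion (Φ.trans conjEquiv.toAffineEquiv) := by
  have hl : ∀ z, (Φ.trans conjEquiv.toAffineEquiv).linear z = conjEquiv (Φ.linear z) :=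
    fun z => rfl
  refine ⟨fun z w => ?_, ?_⟩
  · rw [hl, hl, metric, herm_conjEquiv, Complex.conj_re]
    exact h.1 z w
  · rcases h.2 with h | h
    · exact Or.inr fun z => by rw [hl, hl, h, conjEquiv_cplxJ]
    · exact Or.inl fun z => by rw [hl, hl, h, map_neg, conjEquiv_cplxJ, neg_neg]

/-- Conjugating both coordinates conjugates the Hermitian form and reverses the sign of `sinh θ`;
this is where anti-holomorphic motions enter. -/
theorem congruentToModel_of_const_conj {θ : ℝ} {G : ℝ × ℝ → ℂ × ℂ} {I K : Set ℝ} (hI : IsOpen I)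
    (hI' : I.OrdConnected) (hK : IsOpen K) (hK' : K.OrdConnected)
    (hG : ContDiffOn ℝ ∞ G (I ×ˢ K)) {a : ℂ × ℂ}
    (ha : ∀ q ∈ I ×ˢ K, fderiv ℝ G q (1, 0) = a) (haa : herm a a = 0)
    (hnull : ∀ q ∈ I ×ˢ K, herm (fderiv ℝ G q (0, 1)) (fderiv ℝ G q (0, 1)) = 0)
    (hab : ∀ q ∈ I ×ˢ K, herm a (fderiv ℝ G q (0, 1)) = -1 + Complex.I * (Real.sinh θ : ℂ)) :
    CongruentToModel θ G I K := by
  let c : (ℂ × ℂ) →L[ℝ] (ℂ × ℂ) := LinearMap.toContinuousLinearMap conjEquiv.toLinearMap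
  have hd : ∀ q ∈ I ×ˢ K, ∀ v, fderiv ℝ (fun q => conjEquiv (G q)) q v =
      conjEquiv (fderiv ℝ G q v) := by
    intro q hq v
    have h : HasFDerivAt (fun q => conjEquiv (G q)) (c.comp (fderiv ℝ G q)) q :=
      c.hasFDerivAt.comp q (hG.differentiableAt_of_isOpen (hI.prod hK) hq).hasFDerivAt
    rw [h.fderiv]
    rfl
  obtain ⟨f, hf, Φ, hΦ, h⟩ := congruentToModel_of_const (θ := θ) (a := conjEquiv a)
    (G := fun q => conjEquiv (G q)) hI hI' hK hK' (c.contDiff.comp_contDiffOn hG)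
    (fun q hq => by rw [hd q hq, ha q hq])
    (by rw [herm_conjEquiv, haa, map_zero])
    (fun q hq => by rw [hd q hq, herm_conjEquiv, hnull q hq, map_zero])
    (fun q hq => by
      rw [hd q hq, herm_conjEquiv, hab q hq]
      simp [-Complex.ofReal_sinh]
      ring)
  refine ⟨f, hf, _, hΦ.trans_conjEquiv, fun q hq => ?_⟩
  change G q = conjEquiv (Φ (model θ f q))
  rw [← h q hq, conjEquiv_conjEquiv]

end Congruence

/-! ### Geometry of null rectangles -/

section NullRectangles

/-- By the chain rule the second derivatives of `ξ` and the Christoffel terms contribute only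
tangential vectors. Conditions on the second fundamental form in a chart thereby pass to null
rectangles. -/
theorem exists_fderiv_fderiv_comp {E : Type*} [NormedAddCommGroup E] [NormedSpace ℝ E]
    {F : E2 → ℂ × ℂ} {U : Set E2} {ξ : E → E2} {V : Set E} (hF : ContDiffOn ℝ ∞ F U)
    (hU : IsOpen U) (hξ : ContDiffOn ℝ ∞ ξ V) (hV : IsOpen V) (hm : Set.MapsTo ξ V U) {q : E}
    (hq : q ∈ V) (v w : E) :
    ∃ T ∈ tangentPlane F (ξ q), fderiv ℝ (fun q => fderiv ℝ (F ∘ ξ) q w) q v =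
      T + ∑ i, ∑ j, (fderiv ℝ ξ q v i * fderiv ℝ ξ q w j) • secondForm F i j (ξ q) := by
  let Y : Fin 2 → E → ℝ := fun i x => fderiv ℝ ξ x w i
  have hY : ∀ i, ContDiffOn ℝ ∞ (Y i) V := fun i =>
    (EuclideanSpace.proj i : E2 →L[ℝ] ℝ).contDiff.comp_contDiffOn (hξ.fderiv_apply_const hV w)
  have hFξ : ∀ i, ContDiffOn ℝ ∞ (fun x => pd i F (ξ x)) V := fun i => (hF.pd hU i).comp hξ hm
  have hev : (fun x => fderiv ℝ (F ∘ ξ) x w) =ᶠ[nhds q]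
      fun x => Y 0 x • pd 0 F (ξ x) + Y 1 x • pd 1 F (ξ x) := by
    filter_upwards [hV.mem_nhds hq] with x hx
    rw [fderiv_comp x (hF.differentiableAt_of_isOpen hU (hm hx))
      (hξ.differentiableAt_of_isOpen hV hx)]
    exact fderiv_apply_eq_pd F _ _
  have hd : ∀ i, fderiv ℝ (fun x => pd i F (ξ x)) q v =
      fderiv ℝ ξ q v 0 • pd 0 (pd i F) (ξ q) + fderiv ℝ ξ q v 1 • pd 1 (pd i F) (ξ q) := by
    intro i
    have := fderiv_comp q ((hF.pd hU i).differentiableAt_of_isOpen hU (hm hq))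
      (hξ.differentiableAt_of_isOpen hV hq)
    rw [← fderiv_apply_eq_pd]
    exact congrArg (fun g : E →L[ℝ] ℂ × ℂ => g v) this
  have hYF : ∀ i, ContDiffOn ℝ ∞ (fun x => Y i x • pd i F (ξ x)) V := fun i =>
    (hY i).smul (hFξ i)
  rw [hev.fderiv_eq, fderiv_fun_add ((hYF 0).differentiableAt_of_isOpen hV hq)
    ((hYF 1).differentiableAt_of_isOpen hV hq), add_apply,
    fderiv_smul_apply ((hY 0).differentiableAt_of_isOpen hV hq)
      ((hFξ 0).differentiableAt_of_isOpen hV hq),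
    fderiv_smul_apply ((hY 1).differentiableAt_of_isOpen hV hq)
      ((hFξ 1).differentiableAt_of_isOpen hV hq), hd, hd]
  have m := fun i => pd_mem_tangentPlane F (ξ q) i
  have hs : ∀ (c : ℝ) i, c • pd i F (ξ q) ∈ tangentPlane F (ξ q) := fun c i =>
    Submodule.smul_mem _ _ (m i)
  let D : Fin 2 → Fin 2 → ℂ × ℂ := fun i j =>
    christoffel F 0 i j (ξ q) • pd 0 F (ξ q) + christoffel F 1 i j (ξ q) • pd 1 F (ξ q)
  have hD : ∀ i j, D i j ∈ tangentPlane F (ξ q) := fun i j => add_mem (hs _ _) (hs _ _)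
  have hsD : ∀ (c : ℝ) i j, c • D i j ∈ tangentPlane F (ξ q) := fun c i j =>
    Submodule.smul_mem _ _ (hD i j)
  refine ⟨(fderiv ℝ (Y 0) q v • pd 0 F (ξ q) + Y 0 q •
    (fderiv ℝ ξ q v 0 • D 0 0 + fderiv ℝ ξ q v 1 • D 1 0)) +
    (fderiv ℝ (Y 1) q v • pd 1 F (ξ q) + Y 1 q •
    (fderiv ℝ ξ q v 0 • D 0 1 + fderiv ℝ ξ q v 1 • D 1 1)), ?_, ?_⟩
  · exact add_mem (add_mem (hs _ _) (Submodule.smul_mem _ _ (add_mem (hsD _ _ _) (hsD _ _ _))))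
      (add_mem (hs _ _) (Submodule.smul_mem _ _ (add_mem (hsD _ _ _) (hsD _ _ _))))
  · simp only [pd_pd_eq F _ _ (ξ q), Fin.sum_univ_two, D, Y]
    module

variable {M : Type*} [TopologicalSpace M] [ChartedSpace E2 M] {L : M → ℂ × ℂ} {θ : ℝ}
  {I K : Set ℝ} {φ : ℝ × ℝ → M} {q : ℝ × ℝ}

theorem IsNullRectangle.isOpen (h : IsNullRectangle L I K φ) : IsOpen (I ×ˢ K) :=
  h.open_left.prod h.open_right

theorem IsNullRectangle.contDiffOn (h : IsNullRectangle L I K φ) (hL : IsLorentzianSurface L) :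
    ContDiffOn ℝ ∞ (L ∘ φ) (I ×ˢ K) :=
  contMDiffOn_iff_contDiffOn.1 (hL.smooth.comp_contMDiffOn h.smooth)

theorem IsNullRectangle.isNullPair (h : IsNullRectangle L I K φ) (hq : q ∈ I ×ˢ K) :
    IsNullPair (fderiv ℝ (L ∘ φ) q (1, 0)) (fderiv ℝ (L ∘ φ) q (0, 1)) := by
  refine ⟨?_, ?_, ?_⟩ <;> rw [h.isometric q hq] <;> simp

theorem IsNullRectangle.exists_chart [IsManifold (𝓡 2) ∞ M] (h : IsNullRectangle L I K φ)
    (hq : q ∈ I ×ˢ K) :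
    ∃ e ∈ atlas E2 M, ∃ V ⊆ I ×ˢ K, IsOpen V ∧ q ∈ V ∧ ∃ ξ : ℝ × ℝ → E2, ContDiffOn ℝ ∞ ξ V ∧
      Set.MapsTo ξ V e.target ∧ Set.EqOn (L ∘ φ) ((L ∘ e.symm) ∘ ξ) V := by
  let e := chartAt E2 (φ q)
  have he : e ∈ atlas E2 M := chart_mem_atlas E2 _
  refine ⟨e, he, I ×ˢ K ∩ φ ⁻¹' e.source, Set.inter_subset_left,
    h.smooth.continuousOn.isOpen_inter_preimage h.isOpen e.open_source,
    ⟨hq, mem_chart_source E2 _⟩, e ∘ φ, ?_, fun x hx => e.map_source hx.2, fun x hx => ?_⟩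
  · exact contMDiffOn_iff_contDiffOn.1
      ((contMDiffOn_of_mem_maximalAtlas (IsManifold.subset_maximalAtlas he)).comp
        (h.smooth.mono Set.inter_subset_left) fun x hx => hx.2)
  · simp only [Function.comp_apply]
    rw [e.left_inv hx.2]

/-- In a chart, second derivatives of a null rectangle are given by the second fundamental form. -/
theorem IsNullRectangle.second_derivatives [IsManifold (𝓡 2) ∞ M] (h : IsNullRectangle L I K φ)
    (hL : IsLorentzianSurface L) (hq : q ∈ I ×ˢ K) :
    ∃ e ∈ atlas E2 M, ∃ u ∈ e.target, ∃ A : ℝ × ℝ →L[ℝ] E2,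
      (∀ v, fderiv ℝ (L ∘ φ) q v = fderiv ℝ (L ∘ e.symm) u (A v)) ∧
      LinearMap.range (fderiv ℝ (L ∘ φ) q : ℝ × ℝ →ₗ[ℝ] ℂ × ℂ) = tangentPlane (L ∘ e.symm) u ∧
      ∀ v w, ∃ T ∈ tangentPlane (L ∘ e.symm) u,
        fderiv ℝ (fun q => fderiv ℝ (L ∘ φ) q w) q v =
          T + ∑ i, ∑ j, (A v i * A w j) • secondForm (L ∘ e.symm) i j u := by
  obtain ⟨e, he, V, hVR, hV, hqV, ξ, hξ, hm, hG⟩ := h.exists_chart hq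
  have hF := hL.contDiffOn_chart he
  have hev : ∀ x ∈ V, fderiv ℝ (L ∘ φ) x = fderiv ℝ ((L ∘ e.symm) ∘ ξ) x := by
    intro x hx
    have : (L ∘ φ) =ᶠ[nhds x] (L ∘ e.symm) ∘ ξ := by
      filter_upwards [hV.mem_nhds hx] with y hy using hG hy
    exact this.fderiv_eq
  have h1 : ∀ v, fderiv ℝ (L ∘ φ) q v = fderiv ℝ (L ∘ e.symm) (ξ q) (fderiv ℝ ξ q v) := by
    intro v
    rw [hev q hqV, fderiv_comp q (hF.differentiableAt_of_isOpen e.open_target (hm hqV))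
      (hξ.differentiableAt_of_isOpen hV hqV)]
    rfl
  refine ⟨e, he, ξ q, hm hqV, fderiv ℝ ξ q, h1, ?_, fun v w => ?_⟩
  · have hle : LinearMap.range (fderiv ℝ (L ∘ φ) q : ℝ × ℝ →ₗ[ℝ] ℂ × ℂ) ≤
        tangentPlane (L ∘ e.symm) (ξ q) := by
      rintro _ ⟨v, rfl⟩
      exact ⟨fderiv ℝ ξ q v, (h1 v).symm⟩
    refine le_antisymm hle ?_
    rw [← (h.isNullPair hq).span_eq (hL.lorentzian e he _ (hm hqV)).1 (hle ⟨_, rfl⟩)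
      (hle ⟨_, rfl⟩), Submodule.span_le]
    rintro x (rfl | rfl)
    exacts [⟨_, rfl⟩, ⟨_, rfl⟩]
  · obtain ⟨T, hT, h2⟩ := exists_fderiv_fderiv_comp hF e.open_target hξ hV hm hqV v w
    refine ⟨T, hT, ?_⟩
    rw [← h2]
    have : (fun q => fderiv ℝ (L ∘ φ) q w) =ᶠ[nhds q]
        fun q => fderiv ℝ ((L ∘ e.symm) ∘ ξ) q w := by
      filter_upwards [hV.mem_nhds hqV] with y hy
      rw [hev y hy]
    rw [this.fderiv_eq]

/-- Constant metric coefficients make second derivatives normal, and the tangent plane is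
nondegenerate. -/
theorem IsNullRectangle.eq_zero_of_tangent [IsManifold (𝓡 2) ∞ M] (h : IsNullRectangle L I K φ)
    (hL : IsLorentzianSurface L) (hq : q ∈ I ×ˢ K) {v w : ℝ × ℝ}
    (ht : fderiv ℝ (fun q => fderiv ℝ (L ∘ φ) q w) q v ∈
      LinearMap.range (fderiv ℝ (L ∘ φ) q : ℝ × ℝ →ₗ[ℝ] ℂ × ℂ)) :
    fderiv ℝ (fun q => fderiv ℝ (L ∘ φ) q w) q v = 0 := by
  obtain ⟨e, he, u, hu, -, -, hr, -⟩ := h.second_derivatives hL hq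
  have hn := metric_fderiv_fderiv_eq_zero (h.contDiffOn hL) h.isOpen _ h.isometric hq v w
  rw [(h.isNullPair hq).eq_of_mem (W := LinearMap.range (fderiv ℝ (L ∘ φ) q : ℝ × ℝ →ₗ[ℝ] ℂ × ℂ))
    (by rw [hr]; exact (hL.lorentzian e he _ hu).1) ⟨_, rfl⟩ ⟨_, rfl⟩ ht, hn, hn]
  simp

/-- In null directions the trace of the second fundamental form has only mixed terms, so minimality
makes `L_xy` tangential. -/
theorem IsNullRectangle.mixed_eq_zero [IsManifold (𝓡 2) ∞ M] (h : IsNullRectangle L I K φ)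
    (hL : IsLorentzianSurface L) (hmin : IsMinimal L) (hq : q ∈ I ×ˢ K) :
    fderiv ℝ (fun q => fderiv ℝ (L ∘ φ) q (0, 1)) q (1, 0) = 0 := by
  obtain ⟨e, he, u, hu, A, hA, hr, h2⟩ := h.second_derivatives hL hq
  apply h.eq_zero_of_tangent hL hq
  rw [hr]
  obtain ⟨T, hT, hT'⟩ := h2 (1, 0) (0, 1)
  obtain ⟨S, hS, hS'⟩ := h2 (0, 1) (1, 0)
  rw [fderiv_fderiv_comm (h.contDiffOn hL) h.isOpen hq] at hS'
  have hpair := h.isNullPair hq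
  rw [hA, hA] at hpair
  have hH : meanCurvature (L ∘ e.symm) u = 0 := hmin e he u hu
  simp only [meanCurvature, gram_inv_of_isNullPair hpair] at hH
  have h0 := (smul_eq_zero.1 hH).resolve_left (by norm_num)
  set B := fderiv ℝ (fun q => fderiv ℝ (L ∘ φ) q (0, 1)) q (1, 0)
  -- Adding both orders of differentiation produces exactly the mixed terms of the trace, without
  -- appeal to the symmetry of `secondForm`.
  have hsum : B = (1 / 2 : ℝ) • (T + S) := by
    have hh : B + B = T + S := by
      simp only [Fin.sum_univ_two] at hT' hS' h0
      nth_rewrite 1 [hT']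
      rw [hS', ← sub_eq_zero, ← neg_eq_zero, ← h0]
      module
    rw [← hh]
    module
  rw [hsum]
  exact Submodule.smul_mem _ _ (add_mem hT hS)

theorem IsNullRectangle.second_eq_zero [IsManifold (𝓡 2) ∞ M] (h : IsNullRectangle L I K φ)
    (hL : IsLorentzianSurface L) (hgeo : IsTotallyGeodesic L) (hq : q ∈ I ×ˢ K) (v w : ℝ × ℝ) :
    fderiv ℝ (fun q => fderiv ℝ (L ∘ φ) q w) q v = 0 := by
  obtain ⟨e, he, u, hu, A, hA, hr, h2⟩ := h.second_derivatives hL hq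
  apply h.eq_zero_of_tangent hL hq
  rw [hr]
  obtain ⟨T, hT, hT'⟩ := h2 v w
  have h0 : ∀ i j, secondForm (L ∘ e.symm) i j u = 0 := hgeo e he u hu
  rw [hT']
  simpa [h0] using hT

theorem metric_cplxJ_comb (a b c d : ℝ) (z w : ℂ × ℂ) :
    metric (cplxJ (a • z + b • w)) (c • z + d • w) = (a * d - b * c) * metric (cplxJ z) w := by
  simp [metric_eq_re_im, cplxJ]
  ring

/-- Two null pairs of one plane differ by a change of basis of determinant `±1`, and `⟨J·, ·⟩`
scales by this determinant. Only the square is fixed, as the order of the slant basis is free. -/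
theorem IsNullRectangle.slant [IsManifold (𝓡 2) ∞ M] (h : IsNullRectangle L I K φ)
    (hL : IsLorentzianSurface L) (hslant : IsSlant θ L) (hq : q ∈ I ×ˢ K) :
    metric (cplxJ (fderiv ℝ (L ∘ φ) q (1, 0))) (fderiv ℝ (L ∘ φ) q (0, 1)) ^ 2 =
      Real.sinh θ ^ 2 := by
  obtain ⟨e, he, u, hu, -, -, hr, -⟩ := h.second_derivatives hL hq
  obtain ⟨⟨hrank, -⟩, e₁, he₁, e₂, he₂, h11, h22, h12, ⟨-, hJ⟩, -⟩ := hslant e he u hu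
  rw [← hr] at hrank he₁ he₂ hJ
  have hp := h.isNullPair hq
  set X := fderiv ℝ (L ∘ φ) q (1, 0)
  set Y := fderiv ℝ (L ∘ φ) q (0, 1)
  have x₁ := hp.eq_of_mem hrank ⟨_, rfl⟩ ⟨_, rfl⟩ he₁
  have x₂ := hp.eq_of_mem hrank ⟨_, rfl⟩ ⟨_, rfl⟩ he₂
  have hs := hJ e₂ he₂
  rw [metric_sub_left, metric_smul_left, h12] at hs
  generalize -metric e₁ Y = a at x₁
  generalize -metric e₁ X = b at x₁
  generalize -metric e₂ Y = c at x₂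
  generalize -metric e₂ X = d at x₂
  subst x₁ x₂
  have hxx := hp.left
  have hyy := hp.right
  have hxy := hp.cross
  have hyx := hp.symm.cross
  simp only [metric_add_left, metric_add_right, metric_smul_left, metric_smul_right, hxx, hyy, hxy,
    hyx] at h11 h22 h12
  rw [metric_cplxJ_comb] at hs
  have hab : a * b = 0 := by linarith
  have hsum : a * d + b * c = 1 := by linarith
  have hdiff : (a * d - b * c) ^ 2 = 1 := by
    linear_combination (a * d + b * c + 1) * hsum - 4 * c * d * hab
  linear_combination ((a * d - b * c) * metric (cplxJ X) Y - Real.sinh θ) * hs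
    - metric (cplxJ X) Y ^ 2 * hdiff

theorem herm_eq_of_slant {X Y : ℂ × ℂ} {s : ℝ} (h : IsNullPair X Y) (hs : metric (cplxJ X) Y = s) :
    herm X Y = -1 + Complex.I * (s : ℂ) := by
  apply Complex.ext
  · simpa [metric] using h.cross
  · simp [herm_im, hs]

theorem fderiv_comp_swap {V : Type*} [NormedAddCommGroup V] [NormedSpace ℝ V] (G : ℝ × ℝ → V)
    (q v : ℝ × ℝ) : fderiv ℝ (G ∘ Prod.swap) q v = fderiv ℝ G q.swap v.swap := by
  have := (ContinuousLinearEquiv.prodComm ℝ ℝ ℝ).comp_right_fderiv (f := G) (x := q)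
  exact congrArg (fun g : ℝ × ℝ →L[ℝ] V => g v) this

theorem IsNullRectangle.swap (h : IsNullRectangle L I K φ) :
    IsNullRectangle L K I (φ ∘ Prod.swap) where
  open_left := h.open_right
  interval_left := h.interval_right
  open_right := h.open_left
  interval_right := h.interval_left
  smooth := h.smooth.comp (contMDiffOn_iff_contDiffOn.2
    (ContinuousLinearEquiv.prodComm ℝ ℝ ℝ).contDiff.contDiffOn) fun _ hq => ⟨hq.2, hq.1⟩
  isometric q hq v w := by
    rw [← Function.comp_assoc, fderiv_comp_swap, fderiv_comp_swap, h.isometric _ ⟨hq.2, hq.1⟩]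
    simp only [Prod.fst_swap, Prod.snd_swap]
    ring

theorem IsNullRectangle.congruent [IsManifold (𝓡 2) ∞ M] (h : IsNullRectangle L I K φ)
    (hL : IsLorentzianSurface L) (hmin : IsMinimal L) (hslant : IsSlant θ L) :
    CongruentToModel θ (L ∘ φ) I K ∨ CongruentToModel θ ((L ∘ φ) ∘ Prod.swap) K I := by
  have hR := h.isOpen
  have hG := h.contDiffOn hL
  have hI := h.interval_left
  have hK := h.interval_right
  let X : ℝ × ℝ → ℂ × ℂ := fun q => fderiv ℝ (L ∘ φ) q (1, 0)
  let Y : ℝ × ℝ → ℂ × ℂ := fun q => fderiv ℝ (L ∘ φ) q (0, 1)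
  have hX : ContDiffOn ℝ ∞ X (I ×ˢ K) := hG.fderiv_apply_const hR _
  have hY : ContDiffOn ℝ ∞ Y (I ×ˢ K) := hG.fderiv_apply_const hR _
  have hp : ∀ q ∈ I ×ˢ K, IsNullPair (X q) (Y q) := fun q hq => h.isNullPair hq
  have hYx : ∀ x ∈ I, ∀ x' ∈ I, ∀ y ∈ K, Y (x, y) = Y (x', y) := fun x hx x' hx' y hy =>
    eq_of_fderiv_fst_eq_zero h.open_left hI (fun q hq => hY.differentiableAt_of_isOpen hR hq)
      (fun q hq => h.mixed_eq_zero hL hmin hq) hx hx' hy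
  have hXy : ∀ x ∈ I, ∀ y ∈ K, ∀ y' ∈ K, X (x, y) = X (x, y') := fun x hx y hy y' hy' =>
    eq_of_fderiv_snd_eq_zero h.open_right hK (fun q hq => hX.differentiableAt_of_isOpen hR hq)
      (fun q hq => by
        rw [fderiv_fderiv_comm hG hR hq]; exact h.mixed_eq_zero hL hmin hq) hx hy hy'
  have hpre : IsPreconnected (I ×ˢ K) := hI.isPreconnected.prod hK.isPreconnected
  have hJ : ContinuousOn (fun q => metric (cplxJ (X q)) (Y q)) (I ×ˢ K) := by
    have : ContDiffOn ℝ ∞ (fun q => cplxJ (X q)) (I ×ˢ K) := hX.const_smul Complex.I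
    exact (this.metric hY).continuousOn
  -- A continuous function with constant nonzero square has constant sign on a connected rectangle;
  -- `sinh θ = 0` needs no sign.
  have hsign : ∃ s : ℝ, (s = Real.sinh θ ∨ s = -Real.sinh θ) ∧
      ∀ q ∈ I ×ˢ K, metric (cplxJ (X q)) (Y q) = s := by
    by_cases h0 : Real.sinh θ = 0
    · refine ⟨0, Or.inl h0.symm, fun q hq => ?_⟩
      have := h.slant hL hslant hq
      rw [h0] at this
      simpa using this
    · rcases hpre.eq_or_eq_neg_of_sq_eq hJ (continuousOn_const (c := Real.sinh θ))
        (fun q hq => h.slant hL hslant hq) (fun _ => h0) with h1 | h1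
      · exact ⟨_, Or.inl rfl, fun q hq => h1 hq⟩
      · exact ⟨_, Or.inr rfl, fun q hq => h1 hq⟩
  obtain ⟨s, hs, hXYs⟩ := hsign
  have hherm : ∀ q ∈ I ×ˢ K, herm (X q) (Y q) = -1 + Complex.I * (s : ℂ) := fun q hq =>
    herm_eq_of_slant (hp q hq) (hXYs q hq)
  -- Both vectors can be moved to the common corner `(x, y')`.
  have hcross : ∀ q ∈ I ×ˢ K, ∀ q' ∈ I ×ˢ K,
      herm (X q) (Y q') = -1 + Complex.I * (s : ℂ) := by
    rintro ⟨x, y⟩ ⟨hx, hy⟩ ⟨x', y'⟩ ⟨hx', hy'⟩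
    rw [hXy x hx y hy y' hy', hYx x' hx' x hx y' hy']
    exact hherm _ ⟨hx, hy'⟩
  have hκ : (-1 + Complex.I * (s : ℂ)) ≠ 0 := by
    intro h0
    have := congrArg Complex.re h0
    simp at this
  have hXX : ∀ q ∈ I ×ˢ K, herm (X q) (X q) = 0 := fun q hq => herm_self_eq_zero (hp q hq).left
  have hYY : ∀ q ∈ I ×ˢ K, herm (Y q) (Y q) = 0 := fun q hq => herm_self_eq_zero (hp q hq).right
  rcases (I ×ˢ K).eq_empty_or_nonempty with he | ⟨q₀, hq₀⟩
  · refine Or.inl (congruentToModel_of_const (a := 0) h.open_left hI h.open_right hK hG ?_ ?_ ?_ ?_)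
    · rw [he]; simp
    · simp [herm]
    · rw [he]; simp
    · rw [he]; simp
  have key : ∀ {I K : Set ℝ} {G : ℝ × ℝ → ℂ × ℂ} {a : ℂ × ℂ} {t : ℝ}, IsOpen I → I.OrdConnected →
      IsOpen K → K.OrdConnected → ContDiffOn ℝ ∞ G (I ×ˢ K) →
      (∀ q ∈ I ×ˢ K, fderiv ℝ G q (1, 0) = a) → herm a a = 0 →
      (∀ q ∈ I ×ˢ K, herm (fderiv ℝ G q (0, 1)) (fderiv ℝ G q (0, 1)) = 0) →
      (t = Real.sinh θ ∨ t = -Real.sinh θ) →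
      (∀ q ∈ I ×ˢ K, herm a (fderiv ℝ G q (0, 1)) = -1 + Complex.I * (t : ℂ)) →
      CongruentToModel θ G I K := by
    intro I K G a t h1 h2 h3 h4 h5 h6 h7 h8 ht h9
    rcases ht with rfl | rfl
    · exact congruentToModel_of_const_conj h1 h2 h3 h4 h5 h6 h7 h8 h9
    · refine congruentToModel_of_const h1 h2 h3 h4 h5 h6 h7 h8 fun q hq => ?_
      rw [h9 q hq]
      push_cast
      ring
  by_cases hconst : ∀ q ∈ I ×ˢ K, X q = X q₀
  · exact Or.inl (key h.open_left hI h.open_right hK hG hconst (hXX q₀ hq₀) hYY hs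
      fun q hq => hcross q₀ hq₀ q hq)
  · push Not at hconst
    obtain ⟨q₁, hq₁, hne⟩ := hconst
    have hYc : ∀ q ∈ I ×ˢ K, Y q = Y q₀ := fun q hq =>
      eq_of_herm_eq hκ (hcross q₁ hq₁ q hq) (hcross q₁ hq₁ q₀ hq₀) (hcross q₀ hq₀ q hq)
        (hcross q₀ hq₀ q₀ hq₀) hne
    have hsw : ∀ q ∈ K ×ˢ I, q.swap ∈ I ×ˢ K := fun q hq => ⟨hq.2, hq.1⟩
    -- Exchanging the arguments conjugates the Hermitian product, hence `-s`.
    refine Or.inr (key (a := Y q₀) (t := -s) h.open_right hK h.open_left hI ?_ ?_ (hYY q₀ hq₀) ?_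
      ?_ ?_)
    · exact hG.comp (ContinuousLinearEquiv.prodComm ℝ ℝ ℝ).contDiff.contDiffOn hsw
    · intro q hq
      rw [fderiv_comp_swap]
      exact hYc _ (hsw q hq)
    · intro q hq
      rw [fderiv_comp_swap]
      exact hXX _ (hsw q hq)
    · rcases hs with rfl | rfl
      · exact Or.inr rfl
      · exact Or.inl (neg_neg _)
    · intro q hq
      rw [fderiv_comp_swap]
      change herm (Y q₀) (X q.swap) = _
      rw [← herm_conj, hcross _ (hsw q hq) _ hq₀]
      simp

end NullRectangles

/-! ### Totally geodesic surfaces -/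

section TotallyGeodesic

variable {M : Type*} [TopologicalSpace M] [ChartedSpace E2 M] {L : M → ℂ × ℂ} {θ : ℝ}

theorem IsNullRectangle.eq_affine [IsManifold (𝓡 2) ∞ M] {I K : Set ℝ} {φ : ℝ × ℝ → M}
    (h : IsNullRectangle L I K φ) (hL : IsLorentzianSurface L) (hgeo : IsTotallyGeodesic L)
    {q₀ : ℝ × ℝ} (hq₀ : q₀ ∈ I ×ˢ K) {q : ℝ × ℝ} (hq : q ∈ I ×ˢ K) :
    L (φ q) = L (φ q₀) + fderiv ℝ (L ∘ φ) q₀ (q - q₀) := by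
  have hR := h.isOpen
  have hG := h.contDiffOn hL
  have hpre : IsPreconnected (I ×ˢ K) :=
    h.interval_left.isPreconnected.prod h.interval_right.isPreconnected
  have hc : ∀ q ∈ I ×ˢ K, fderiv ℝ (L ∘ φ) q = fderiv ℝ (L ∘ φ) q₀ := by
    intro q hq
    refine ContinuousLinearMap.ext fun w => ?_
    exact hR.is_const_of_fderiv_eq_zero (𝕜 := ℝ) (f := fun q => fderiv ℝ (L ∘ φ) q w) hpre
      (fun x hx => ((hG.fderiv_apply_const hR w).differentiableAt_of_isOpen hR
        hx).differentiableWithinAt)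
      (fun x hx => ContinuousLinearMap.ext fun v => h.second_eq_zero hL hgeo hx v w) hq hq₀
  have hd : ∀ q ∈ I ×ˢ K,
      HasFDerivAt (fun q => (L ∘ φ) q - fderiv ℝ (L ∘ φ) q₀ q) (0 : ℝ × ℝ →L[ℝ] ℂ × ℂ) q := by
    intro q hq
    have := (hG.differentiableAt_of_isOpen hR hq).hasFDerivAt.sub (fderiv ℝ (L ∘ φ) q₀).hasFDerivAt
    rwa [hc q hq, sub_self] at this
  have := hR.is_const_of_fderiv_eq_zero (𝕜 := ℝ) hpre
    (fun x hx => (hd x hx).differentiableAt.differentiableWithinAt)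
    (fun x hx => (hd x hx).fderiv) hq hq₀
  simp only [Function.comp_apply] at this
  rw [map_sub, ← sub_eq_iff_eq_add']
  rw [sub_eq_sub_iff_add_eq_add] at this ⊢
  rw [this]
  abel

/-- On a null rectangle `L` is affine with injective linear part `T`. The final clause, that every
nonempty open part of `N` already spans `A`, serves to compare planes on overlaps. -/
theorem exists_local_plane [IsManifold (𝓡 2) ∞ M] (hL : IsLorentzianSurface L)
    (hflat : IsFlat L) (hslant : IsSlant θ L) (hgeo : IsTotallyGeodesic L) (p : M) :
    ∃ (A : AffineSubspace ℝ (ℂ × ℂ)) (N : Set M) (O : Set (ℂ × ℂ)), IsSlantPlane θ A.direction ∧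
      IsOpen N ∧ p ∈ N ∧ IsOpen O ∧ L '' N = (A : Set (ℂ × ℂ)) ∩ O ∧
      ∀ N' ⊆ N, IsOpen N' → N'.Nonempty → ∀ B : AffineSubspace ℝ (ℂ × ℂ),
        L '' N' ⊆ B → A ≤ B := by
  obtain ⟨I, K, φ, h, -, ⟨q₀, hq₀, rfl⟩, hopen⟩ := exists_isNullRectangle hL hflat hslant p
  set T := fderiv ℝ (L ∘ φ) q₀ with hT
  have haff : ∀ q ∈ I ×ˢ K, ∀ q' ∈ I ×ˢ K, L (φ q) = L (φ q') + T (q - q') := by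
    intro q hq q' hq'
    rw [h.eq_affine hL hgeo hq₀ hq, h.eq_affine hL hgeo hq₀ hq', add_assoc, ← map_add]
    congr 2
    abel
  have hinj : LinearMap.ker (T : ℝ × ℝ →ₗ[ℝ] ℂ × ℂ) = ⊥ := by
    rw [LinearMap.ker_eq_bot']
    intro v hv
    replace hv : T v = 0 := hv
    have h1 := h.isometric q₀ hq₀ v (1, 0)
    have h2 := h.isometric q₀ hq₀ v (0, 1)
    rw [← hT, hv, metric_zero_left] at h1 h2
    ext1
    · simpa using h2
    · simpa using h1
  obtain ⟨S, hS⟩ := LinearMap.exists_leftInverse_of_injective _ hinj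
  have hST : ∀ v, S (T v) = v := fun v => congrArg (fun g : ℝ × ℝ →ₗ[ℝ] ℝ × ℝ => g v) hS
  have hSc : Continuous S := S.continuous_of_finiteDimensional
  -- A left inverse `S` of `T` extends the coordinates to all of `ℂ²`; the preimage of the rectangle
  -- is the required open set.
  refine ⟨AffineSubspace.mk' (L (φ q₀)) (LinearMap.range (T : ℝ × ℝ →ₗ[ℝ] ℂ × ℂ)), φ '' (I ×ˢ K),
    (fun z => S (z - L (φ q₀)) + q₀) ⁻¹' (I ×ˢ K), ?_, hopen, ⟨q₀, hq₀, rfl⟩,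
    h.isOpen.preimage (by fun_prop), ?_, ?_⟩
  · rw [AffineSubspace.direction_mk']
    obtain ⟨e, he, u, hu, -, -, hr, -⟩ := h.second_derivatives hL hq₀
    rw [hr]
    exact hslant e he u hu
  · ext z
    constructor
    · rintro ⟨_, ⟨q, hq, rfl⟩, rfl⟩
      rw [haff q hq q₀ hq₀]
      refine ⟨?_, ?_⟩
      · rw [SetLike.mem_coe, AffineSubspace.mem_mk', vsub_eq_sub, add_sub_cancel_left]
        exact ⟨_, rfl⟩
      · rw [Set.mem_preimage, add_sub_cancel_left, hST, sub_add_cancel]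
        exact hq
    · rintro ⟨hz, hzO⟩
      rw [SetLike.mem_coe, AffineSubspace.mem_mk', vsub_eq_sub] at hz
      obtain ⟨v, hv⟩ := hz
      replace hv : T v = z - L (φ q₀) := hv
      rw [Set.mem_preimage, ← hv, hST] at hzO
      refine ⟨_, ⟨_, hzO, rfl⟩, ?_⟩
      rw [haff _ hzO q₀ hq₀, add_sub_cancel_right, hv]
      abel
  · rintro N' hN' hN'o ⟨_, hn⟩ B hB
    obtain ⟨q₁, hq₁, rfl⟩ := hN' hn
    have hop : IsOpen (I ×ˢ K ∩ φ ⁻¹' N') :=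
      h.smooth.continuousOn.isOpen_inter_preimage h.isOpen hN'o
    have hB₁ : L (φ q₁) ∈ B := hB ⟨_, hn, rfl⟩
    have hdir : ∀ v, T v ∈ B.direction := by
      intro v
      have hcont : Filter.Tendsto (fun t : ℝ => q₁ + t • v) (nhds 0) (nhds q₁) := by
        have : Continuous fun t : ℝ => q₁ + t • v := by fun_prop
        simpa using this.tendsto 0
      have hev : ∀ᶠ t : ℝ in nhdsWithin 0 {0}ᶜ, q₁ + t • v ∈ I ×ˢ K ∩ φ ⁻¹' N' ∧ t ≠ 0 :=
        ((hcont.eventually (hop.mem_nhds ⟨hq₁, hn⟩)).filter_mono nhdsWithin_le_nhds).and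
          self_mem_nhdsWithin
      obtain ⟨t, ⟨ht, htN⟩, ht0⟩ := hev.exists
      have h1 := AffineSubspace.vsub_mem_direction (hB ⟨_, htN, rfl⟩) hB₁
      rw [vsub_eq_sub, haff _ ht q₁ hq₁, add_sub_cancel_left, add_sub_cancel_left, map_smul] at h1
      exact (Submodule.smul_mem_iff _ ht0).1 h1
    intro z hz
    rw [AffineSubspace.mem_mk', vsub_eq_sub] at hz
    obtain ⟨v, hv⟩ := hz
    replace hv : T v = z - L (φ q₀) := hv
    have hz' : z = T (v + (q₀ - q₁)) +ᵥ L (φ q₁) := by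
      rw [vadd_eq_add, map_add, hv, haff q₀ hq₀ q₁ hq₁]
      abel
    rw [hz']
    exact AffineSubspace.vadd_mem_of_mem_direction (hdir _) hB₁

/-- The local plane is a locally constant function of the point, hence constant on the connected
surface; the open sets `O p` are united. -/
theorem isOpenPieceOfSlantPlane [IsManifold (𝓡 2) ∞ M] [ConnectedSpace M]
    (hL : IsLorentzianSurface L) (hflat : IsFlat L) (hslant : IsSlant θ L)
    (hgeo : IsTotallyGeodesic L) : IsOpenPieceOfSlantPlane θ L := by
  choose A N O hA hN hpN hO himg huniq using exists_local_plane hL hflat hslant hgeo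
  have hsub : ∀ p, L '' N p ⊆ A p := fun p => by
    rw [himg p]
    exact Set.inter_subset_left
  have hle : ∀ p q : M, q ∈ N p → A p = A q := by
    intro p q hq
    have hn : (N p ∩ N q).Nonempty := ⟨q, hq, hpN q⟩
    have ho : IsOpen (N p ∩ N q) := (hN p).inter (hN q)
    exact le_antisymm
      (huniq p _ Set.inter_subset_left ho hn _
        ((Set.image_mono Set.inter_subset_right).trans (hsub q)))
      (huniq q _ Set.inter_subset_right ho hn _
        ((Set.image_mono Set.inter_subset_left).trans (hsub p)))
  have hconst : IsLocallyConstant A := (IsLocallyConstant.iff_exists_open A).2 fun p =>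
    ⟨N p, hN p, hpN p, fun q hq => (hle p q hq).symm⟩
  obtain ⟨p₀⟩ : Nonempty M := inferInstance
  have hAp : ∀ p, A p = A p₀ := fun p => hconst.apply_eq_of_preconnectedSpace p p₀
  refine ⟨A p₀, hA p₀, ⋃ p, O p, isOpen_iUnion hO, ?_⟩
  rw [Set.inter_iUnion, ← Set.image_univ, ← Set.iUnion_eq_univ_iff.2 fun p => ⟨p, hpN p⟩,
    Set.image_iUnion]
  exact Set.iUnion_congr fun p => by rw [himg p, hAp p]

end TotallyGeodesic

end LorentzianC2

end

/-! ### The classification. -/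

open LorentzianC2 in
theorem corollary5p1 {M : Type*} [TopologicalSpace M] [ChartedSpace E2 M]
    [IsManifold (𝓡 2) ∞ M] [ConnectedSpace M] (θ : ℝ) (L : M → ℂ × ℂ)
    (hL : IsLorentzianSurface L) (hmin : IsMinimal L) (hflat : IsFlat L)
    (hslant : IsSlant θ L) :
    IsOpenPieceOfSlantPlane θ L ∨
      (¬ IsTotallyGeodesic L ∧
        (∀ p : M, ∃ (I K : Set ℝ) (φ : ℝ × ℝ → M),
          IsNullRectangle L I K φ ∧ Set.InjOn φ (I ×ˢ K) ∧ p ∈ φ '' (I ×ˢ K) ∧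
            CongruentToModel θ (L ∘ φ) I K) ∧
        (∀ (I K : Set ℝ) (φ : ℝ × ℝ → M), IsNullRectangle L I K φ →
          CongruentToModel θ (L ∘ φ) I K ∨
            CongruentToModel θ ((L ∘ φ) ∘ Prod.swap) K I)) := by
  -- Congruence with the model holds in both cases; total geodesy only separates the alternatives.
  by_cases hgeo : IsTotallyGeodesic L
  · exact Or.inl (isOpenPieceOfSlantPlane hL hflat hslant hgeo)
  refine Or.inr ⟨hgeo, fun p => ?_, fun I K φ h => h.congruent hL hmin hslant⟩
  obtain ⟨I, K, φ, h, hinj, hp, -⟩ := exists_isNullRectangle hL hflat hslant p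
  rcases h.congruent hL hmin hslant with hc | hc
  · exact ⟨I, K, φ, h, hinj, hp, hc⟩
  · refine ⟨K, I, φ ∘ Prod.swap, h.swap, ?_, ?_, hc⟩
    · exact hinj.comp Prod.swap_injective.injOn fun q hq => ⟨hq.2, hq.1⟩
    · obtain ⟨q, hq, rfl⟩ := hp
      exact ⟨q.swap, ⟨hq.2, hq.1⟩, by simp⟩
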